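/- Let $X\subseteq\mathbb N\times\mathbb N$. A (small, symmetric) \emph{$X$-ary $\ast$-polycategory} $\mathcal P$ consists of the following. (i) A set of objects with a strict involution $A\mapsto A^{\bullet}$, $A^{\bullet\bullet}=A$. For a list $\Gamma$ of objects, $\Gamma^\bullet$ denotes the list obtained by applying $(-)^\bullet$ to each entry. (ii) A set $\mathcal P(\Gamma;\Delta)$ for each pair of finite lists of objects with $(|\Gamma|,|\Delta|)\in X$. (iii) For each object-preserving permutation $\sigma:\Gamma,\Delta^\bullet\cong\Lambda,\Sigma^\bullet$, a map $(-)^\sigma:\mathcal P(\Gamma;\Delta)\to\mathcal P(\Lambda;\Sigma)$ whenever both sets exist, functorial in $\sigma$. (iv) Identities $1^m_A\in\mathcal P(A;A)$, $1^l_A\in\mathcal P(A^\bullet,A;\,)$, $1^r_A\in\mathcal P(\,;A,A^\bullet)$, each whenever the relevant set exists; any two that exist are each other's images under the evident permutation. (v) Composition maps, whenever the three sets involved exist, $$\circ^m_A:\mathcal P(\Lambda_1,A,\Lambda_2;\Sigma)\times\mathcal P(\Gamma;\Delta_1,A,\Delta_2)\to\mathcal P(\Lambda_1,\Gamma,\Lambda_2;\Delta_1,\Sigma,\Delta_2),$$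 $$\circ^l_A:\mathcal P(\Lambda_1,A,\Lambda_2;\Sigma)\times\mathcal P(\Gamma_1,A^\bullet,\Gamma_2;\Delta)\to\mathcal P(\Lambda_1,\Lambda_2,\Gamma_1,\Gamma_2;\Delta,\Sigma),$$ $$\circ^r_A:\mathcal P(\Lambda;\Sigma_1,A^\bullet,\Sigma_2)\times\mathcal P(\Gamma;\Delta_1,A,\Delta_2)\to\mathcal P(\Lambda,\Gamma;\Delta_1,\Delta_2,\Sigma_1,\Sigma_2).$$ These are required to satisfy the following axioms, each up to the evident permutations and whenever both sides exist. The three compositions are equivariant and agree with each other, and each composite of $g$ and $f$ along $A$ agrees with the composites of $f$ and $g$ along $A^\bullet$. Moreover $1_A\circ_A f=f$ and $f\circ_A 1_A=f$, and $$(h\circ_B g)\circ_A f=h\circ_B(g\circ_A f),\qquad (h\circ_B g)\circ_A f=(h\circ_A f)\circ_B g,\qquad h\circ_B(g\circ_A f)=g\circ_A(h\circ_B f).$$ Let $\ast\mathrm{Poly}_X$ be the category of $X$-ary $\ast$-polycategories and structure-preserving functors (strictly preserving the involution, the permutation actions, the identities and the compositions). For $Y\subseteq X$ let $U:\ast\mathrm{Poly}_X\to\ast\mathrm{Poly}_Y$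 be the functor that forgets the morphisms whose arity is not in $Y$ and the operations relating to them. \textbf{Theorem.} Let $(X,Y)$ be one of the three pairs $$(\mathbb N\times\{0\},\ \mathbb N_{>0}\times\{0\}),\qquad (\mathbb N\times\mathbb N,\ \{(m,n): m+n>0\}),\qquad (\mathbb N\times\{0,1\},\ \mathbb N\times\{1\}).$$ (In the third case $U$ takes a co-subunary $\ast$-polycategory to its underlying cyclic symmetric multicategory.) Then $U:\ast\mathrm{Poly}_X\to\ast\mathrm{Poly}_Y$ has both a left adjoint $L$ and a right adjoint $R$, each of which is fully faithful (equivalently, the unit $\mathrm{Id}\to UL$ and the counit $UR\to\mathrm{Id}$ are isomorphisms). Moreover, for every $\mathcal P$ in $\ast\mathrm{Poly}_X$, the components $LU\mathcal P\to\mathcal P$ of the counit of $L\dashv U$ and $\mathcal P\to RU\mathcal P$ of the unit of $U\dashv R$ are bijective on objects and fully faithful except on $(0,0)$-ary morphisms, i.e. they are bijective on the morphism sets $(\Gamma;\Delta)$ with $(|\Gamma|,|\Delta|)\in X\setminus\{(0,0)\}$. -/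

import Mathlib

open CategoryTheory

universe u

namespace StarPoly

/-- A two-sided sequent `(Γ; Δ)` of objects from `O` whose arity `(|Γ|, |Δ|)` lies in `X`.
A finite list of length `n` is represented as a tuple `Fin n → O`. -/
structure Sequent (X : Set (ℕ × ℕ)) (O : Type u) : Type u where
  m : ℕ
  n : ℕ
  mem : (m, n) ∈ X
  dom : Fin m → O
  cod : Fin n → O

namespace Sequent

variable {X Y : Set (ℕ × ℕ)} {O : Type u} {O₂ : Type u}

/-- The places of a sequent `(Γ; Δ)`, i.e. the places of the concatenated list `Γ, Δ•`. -/
abbrev Entry (s : Sequent X O) : Type := Fin s.m ⊕ Fin s.n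

/-- The object of the list `Γ, Δ•` at a given place. -/
def label [InvolutiveStar O] (s : Sequent X O) : s.Entry → O :=
  Sum.elim s.dom (fun j => star (s.cod j))

/-- The places of `Γ`, in order. -/
def domEntries (s : Sequent X O) : List s.Entry := (List.finRange s.m).map Sum.inl

/-- The places of `Δ`, in order. -/
def codEntries (s : Sequent X O) : List s.Entry := (List.finRange s.n).map Sum.inr

/-- Apply a function on objects to every object of a sequent. -/
def map (φ : O → O₂) (s : Sequent X O) : Sequent X O₂ where
  m := s.m
  n := s.n
  mem := s.mem
  dom := φ ∘ s.dom
  cod := φ ∘ s.cod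

/-- If `Y ⊆ X`, a sequent with arity in `Y` is a sequent with arity in `X`. -/
def incl (h : Y ⊆ X) (s : Sequent Y O) : Sequent X O where
  m := s.m
  n := s.n
  mem := h s.mem
  dom := s.dom
  cod := s.cod

theorem label_map [InvolutiveStar O] [InvolutiveStar O₂] (φ : O → O₂)
    (hφ : ∀ A, φ (star A) = star (φ A)) (s : Sequent X O) (x : s.Entry) :
    (s.map φ).label x = φ (s.label x) := by
  cases x with
  | inl i => rfl
  | inr j => exact (hφ (s.cod j)).symm

end Sequent

section Data

variable {X Y : Set (ℕ × ℕ)} {O : Type u} [InvolutiveStar O] {O₂ : Type u} [InvolutiveStar O₂]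

/-- An isomorphism of lists `Γ, Δ• ≅ Λ, Σ•`: an object-preserving permutation of places. -/
structure SeqIso (s t : Sequent X O) : Type where
  perm : s.Entry ≃ t.Entry
  label_perm : ∀ x, t.label (perm x) = s.label x

/-- The identity permutation. -/
def SeqIso.refl (s : Sequent X O) : SeqIso s s := ⟨Equiv.refl _, fun _ => rfl⟩

/-- Composition of permutations, in diagrammatic order. -/
def SeqIso.trans {s t w : Sequent X O} (σ : SeqIso s t) (τ : SeqIso t w) : SeqIso s w :=
  ⟨σ.perm.trans τ.perm, fun x => (τ.label_perm _).trans (σ.label_perm x)⟩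

/-- The same permutation, between the images of the lists under a function on objects. -/
def SeqIso.map (φ : O → O₂) (hφ : ∀ A, φ (star A) = star (φ A)) {s t : Sequent X O}
    (σ : SeqIso s t) : SeqIso (s.map φ) (t.map φ) where
  perm := σ.perm
  label_perm x := by
    have h1 := Sequent.label_map φ hφ t (σ.perm x)
    have h2 := Sequent.label_map φ hφ s x
    rw [σ.label_perm x] at h1
    exact h1.trans h2.symm

/-- The same permutation, with the sequents regarded as having arity in a larger set. -/
def SeqIso.incl (h : Y ⊆ X) {s t : Sequent Y O} (σ : SeqIso s t) :
    SeqIso (s.incl h) (t.incl h) where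
  perm := σ.perm
  label_perm := σ.label_perm

/-- `Ident A s` says that `s` is one of the sequents carrying an identity of `A`, namely
`(A; A)`, `(A•, A; )` or `( ; A, A•)`.  Here `pos` and `neg` are the places of the
list `Γ, Δ•` that are occupied by `A` and by `A•` respectively. -/
structure Ident (A : O) (s : Sequent X O) : Type where
  pos : s.Entry
  neg : s.Entry
  label_pos : s.label pos = A
  label_neg : s.label neg = star A
  shape :
    (s.domEntries = [pos] ∧ s.codEntries = [neg]) ∨
    (s.domEntries = [neg, pos] ∧ s.codEntries = []) ∨
    (s.domEntries = [] ∧ s.codEntries = [neg, pos])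

def Ident.map (φ : O → O₂) (hφ : ∀ A, φ (star A) = star (φ A)) {A : O} {s : Sequent X O}
    (i : Ident A s) : Ident (φ A) (s.map φ) where
  pos := i.pos
  neg := i.neg
  label_pos := (Sequent.label_map φ hφ s i.pos).trans (congrArg φ i.label_pos)
  label_neg := (Sequent.label_map φ hφ s i.neg).trans ((congrArg φ i.label_neg).trans (hφ A))
  shape := i.shape

def Ident.incl (h : Y ⊆ X) {A : O} {s : Sequent Y O} (i : Ident A s) : Ident A (s.incl h) where
  pos := i.pos
  neg := i.neg
  label_pos := i.label_pos
  label_neg := i.label_neg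
  shape := i.shape

/-- The three ways in which the places of a composite sequent `r` are obtained from the places
of `g` other than the cut place `eg` and the places of `f` other than the cut place `ef`;
`src` tells which place of `g` or `f` each place of `r` comes from. -/
inductive CutShape {g f r : Sequent X O} (eg : g.Entry) (ef : f.Entry)
    (src : r.Entry → g.Entry ⊕ f.Entry) : Prop
  /-- `(Λ₁, A, Λ₂; Σ)` and `(Γ; Δ₁, A, Δ₂)` give `(Λ₁, Γ, Λ₂; Δ₁, Σ, Δ₂)`. -/
  | m (Λ₁ Λ₂ : List g.Entry) (Δ₁ Δ₂ : List f.Entry)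
      (hg : g.domEntries = Λ₁ ++ eg :: Λ₂)
      (hf : f.codEntries = Δ₁ ++ ef :: Δ₂)
      (hdom : r.domEntries.map src =
        Λ₁.map Sum.inl ++ f.domEntries.map Sum.inr ++ Λ₂.map Sum.inl)
      (hcod : r.codEntries.map src =
        Δ₁.map Sum.inr ++ g.codEntries.map Sum.inl ++ Δ₂.map Sum.inr) :
      CutShape eg ef src
  /-- `(Λ₁, A, Λ₂; Σ)` and `(Γ₁, A•, Γ₂; Δ)` give `(Λ₁, Λ₂, Γ₁, Γ₂; Δ, Σ)`. -/
  | l (Λ₁ Λ₂ : List g.Entry) (Γ₁ Γ₂ : List f.Entry)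
      (hg : g.domEntries = Λ₁ ++ eg :: Λ₂)
      (hf : f.domEntries = Γ₁ ++ ef :: Γ₂)
      (hdom : r.domEntries.map src =
        Λ₁.map Sum.inl ++ Λ₂.map Sum.inl ++ Γ₁.map Sum.inr ++ Γ₂.map Sum.inr)
      (hcod : r.codEntries.map src =
        f.codEntries.map Sum.inr ++ g.codEntries.map Sum.inl) :
      CutShape eg ef src
  /-- `(Λ; Σ₁, A•, Σ₂)` and `(Γ; Δ₁, A, Δ₂)` give `(Λ, Γ; Δ₁, Δ₂, Σ₁, Σ₂)`. -/
  | r (S₁ S₂ : List g.Entry) (Δ₁ Δ₂ : List f.Entry)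
      (hg : g.codEntries = S₁ ++ eg :: S₂)
      (hf : f.codEntries = Δ₁ ++ ef :: Δ₂)
      (hdom : r.domEntries.map src =
        g.domEntries.map Sum.inl ++ f.domEntries.map Sum.inr)
      (hcod : r.codEntries.map src =
        Δ₁.map Sum.inr ++ Δ₂.map Sum.inr ++ S₁.map Sum.inl ++ S₂.map Sum.inl) :
      CutShape eg ef src

/-- `Cut g f r` is the datum of a place in `g` and a place in `f` along which a morphism of
type `g` and a morphism of type `f` can be composed by one of the three composition operations
`∘ᵐ`, `∘ˡ`, `∘ʳ`, with a composite of type `r`.  If the composition is along the object `A`,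
then in the lists `Γ, Δ•` the place in `g` is occupied by `A` and the place in `f` by `A•`,
for each of the three operations. -/
structure Cut (g f r : Sequent X O) : Type where
  eg : g.Entry
  ef : f.Entry
  label_cut : f.label ef = star (g.label eg)
  src : r.Entry → g.Entry ⊕ f.Entry
  label_src : ∀ x, r.label x = Sum.elim g.label f.label (src x)
  shape : CutShape eg ef src

def Cut.map (φ : O → O₂) (hφ : ∀ A, φ (star A) = star (φ A)) {g f r : Sequent X O}
    (c : Cut g f r) : Cut (g.map φ) (f.map φ) (r.map φ) where
  eg := c.eg
  ef := c.ef
  label_cut := (Sequent.label_map φ hφ f c.ef).trans <| (congrArg φ c.label_cut).trans <|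
    (hφ _).trans (congrArg star (Sequent.label_map φ hφ g c.eg).symm)
  src := c.src
  label_src x := by
    refine (Sequent.label_map φ hφ r x).trans ((congrArg φ (c.label_src x)).trans ?_)
    rcases c.src x with y | y
    · exact (Sequent.label_map φ hφ g y).symm
    · exact (Sequent.label_map φ hφ f y).symm
  shape := by
    cases c.shape with
    | m Λ₁ Λ₂ Δ₁ Δ₂ hg hf hd hc => exact .m Λ₁ Λ₂ Δ₁ Δ₂ hg hf hd hc
    | l Λ₁ Λ₂ Γ₁ Γ₂ hg hf hd hc => exact .l Λ₁ Λ₂ Γ₁ Γ₂ hg hf hd hc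
    | r S₁ S₂ Δ₁ Δ₂ hg hf hd hc => exact .r S₁ S₂ Δ₁ Δ₂ hg hf hd hc

def Cut.incl (h : Y ⊆ X) {g f r : Sequent Y O} (c : Cut g f r) :
    Cut (g.incl h) (f.incl h) (r.incl h) where
  eg := c.eg
  ef := c.ef
  label_cut := c.label_cut
  src := c.src
  label_src := c.label_src
  shape := by
    cases c.shape with
    | m Λ₁ Λ₂ Δ₁ Δ₂ hg hf hd hc => exact .m Λ₁ Λ₂ Δ₁ Δ₂ hg hf hd hc
    | l Λ₁ Λ₂ Γ₁ Γ₂ hg hf hd hc => exact .l Λ₁ Λ₂ Γ₁ Γ₂ hg hf hd hc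
    | r S₁ S₂ Δ₁ Δ₂ hg hf hd hc => exact .r S₁ S₂ Δ₁ Δ₂ hg hf hd hc

end Data

/-- Reordering of a threefold disjoint union: exchange the last two summands. -/
def swapRight {α β γ : Type} : (α ⊕ β) ⊕ γ → (α ⊕ γ) ⊕ β :=
  Sum.elim (Sum.elim (fun a => .inl (.inl a)) .inr) (fun c => .inl (.inr c))

/-- Reordering of a threefold disjoint union: exchange the first two summands. -/
def swapLeft {α β γ : Type} : α ⊕ (β ⊕ γ) → β ⊕ (α ⊕ γ) :=
  Sum.elim (fun a => .inr (.inl a)) (Sum.elim .inl (fun c => .inr (.inr c)))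

end StarPoly

open StarPoly in
/-- A (small, symmetric) `X`-ary `∗`-polycategory.  The strict involution `A ↦ A•` on objects is
written `star`.  A permutation relating two sides of an axiom is the evident one: it is
characterized by the places of the given morphisms from which the places of the composites
come. -/
structure StarPolycat (X : Set (ℕ × ℕ)) : Type (u + 1) where
  Obj : Type u
  [involution : InvolutiveStar Obj]
  /-- The set of polyarrows of each type `(Γ; Δ)` of arity in `X`. -/
  Hom : Sequent X Obj → Type u
  /-- The action of isomorphisms of lists. -/
  act : ∀ {s t : Sequent X Obj}, SeqIso s t → Hom s → Hom t
  act_refl : ∀ {s : Sequent X Obj} (x : Hom s), act (SeqIso.refl s) x = x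
  act_trans : ∀ {s t w : Sequent X Obj} (σ : SeqIso s t) (τ : SeqIso t w) (x : Hom s),
    act (σ.trans τ) x = act τ (act σ x)
  /-- The identities `1ᵐ`, `1ˡ`, `1ʳ`. -/
  one : ∀ {A : Obj} {s : Sequent X Obj}, Ident A s → Hom s
  /-- The identities of `A` are each other's images under the relevant permutations. -/
  act_one : ∀ {A : Obj} {s t : Sequent X Obj} (i : Ident A s) (j : Ident A t) (σ : SeqIso s t),
    σ.perm i.pos = j.pos → σ.perm i.neg = j.neg → act σ (one i) = one j
  /-- The compositions `∘ᵐ`, `∘ˡ`, `∘ʳ`. -/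
  comp : ∀ {g f r : Sequent X Obj}, Cut g f r → Hom g → Hom f → Hom r
  /-- Equivariance of the three compositions along an object `A`, and their agreement with each
  other up to the relevant permutations. -/
  comp_act : ∀ {g f r g₁ f₁ r₁ : Sequent X Obj} (c : Cut g f r) (c₁ : Cut g₁ f₁ r₁)
    (ρ : SeqIso g g₁) (σ : SeqIso f f₁) (τ : SeqIso r r₁) (y : Hom g) (x : Hom f),
    ρ.perm c.eg = c₁.eg → σ.perm c.ef = c₁.ef →
    (∀ z, c₁.src (τ.perm z) = Sum.map ρ.perm σ.perm (c.src z)) →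
    comp c₁ (act ρ y) (act σ x) = act τ (comp c y x)
  /-- Agreement of the compositions of `g` and `f` along `A` with the compositions of `f` and `g`
  along `A•`, up to the relevant permutations. -/
  comp_swap : ∀ {g f r g₁ f₁ r₁ : Sequent X Obj} (c : Cut g f r) (c₁ : Cut f₁ g₁ r₁)
    (ρ : SeqIso g g₁) (σ : SeqIso f f₁) (τ : SeqIso r r₁) (y : Hom g) (x : Hom f),
    ρ.perm c.eg = c₁.ef → σ.perm c.ef = c₁.eg →
    (∀ z, c₁.src (τ.perm z) = (Sum.map ρ.perm σ.perm (c.src z)).swap) →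
    comp c₁ (act σ x) (act ρ y) = act τ (comp c y x)
  /-- `1 ∘ f = f`. -/
  one_comp : ∀ {A : Obj} {s f r : Sequent X Obj} (i : Ident A s) (c : Cut s f r)
    (τ : SeqIso r f) (x : Hom f), c.eg = i.pos →
    (∀ z, τ.perm z = Sum.elim (fun _ => c.ef) id (c.src z)) →
    act τ (comp c (one i) x) = x
  /-- `f ∘ 1 = f`. -/
  comp_one : ∀ {A : Obj} {g s r : Sequent X Obj} (i : Ident A s) (c : Cut g s r)
    (τ : SeqIso r g) (y : Hom g), c.ef = i.neg →
    (∀ z, τ.perm z = Sum.elim id (fun _ => c.eg) (c.src z)) →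
    act τ (comp c y (one i)) = y
  /-- `(h ∘_B g) ∘_A f = h ∘_B (g ∘_A f)`. -/
  assoc : ∀ {h g f u r v r₁ : Sequent X Obj} (c₁ : Cut h g u) (c₂ : Cut u f r)
    (c₃ : Cut g f v) (c₄ : Cut h v r₁) (τ : SeqIso r r₁) (z : Hom h) (y : Hom g) (x : Hom f),
    c₄.eg = c₁.eg → c₃.src c₄.ef = .inl c₁.ef →
    c₁.src c₂.eg = .inr c₃.eg → c₂.ef = c₃.ef →
    (∀ w, Sum.map id c₃.src (c₄.src (τ.perm w)) =
      Equiv.sumAssoc _ _ _ (Sum.map c₁.src id (c₂.src w))) →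
    comp c₄ z (comp c₃ y x) = act τ (comp c₂ (comp c₁ z y) x)
  /-- `(h ∘_B g) ∘_A f = ((h ∘_A f) ∘_B g)^σ`. -/
  assoc_right : ∀ {h g f u r v r₁ : Sequent X Obj} (c₁ : Cut h g u) (c₂ : Cut u f r)
    (c₃ : Cut h f v) (c₄ : Cut v g r₁) (τ : SeqIso r r₁) (z : Hom h) (y : Hom g) (x : Hom f),
    c₃.src c₄.eg = .inl c₁.eg → c₄.ef = c₁.ef →
    c₁.src c₂.eg = .inl c₃.eg → c₂.ef = c₃.ef →
    (∀ w, Sum.map c₃.src id (c₄.src (τ.perm w)) =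
      swapRight (Sum.map c₁.src id (c₂.src w))) →
    comp c₄ (comp c₃ z x) y = act τ (comp c₂ (comp c₁ z y) x)
  /-- `h ∘_B (g ∘_A f) = (g ∘_A (h ∘_B f))^σ`. -/
  assoc_left : ∀ {h g f u r v r₁ : Sequent X Obj} (c₁ : Cut g f u) (c₂ : Cut h u r)
    (c₃ : Cut h f v) (c₄ : Cut g v r₁) (τ : SeqIso r r₁) (z : Hom h) (y : Hom g) (x : Hom f),
    c₄.eg = c₁.eg → c₃.src c₄.ef = .inr c₁.ef →
    c₂.eg = c₃.eg → c₁.src c₂.ef = .inr c₃.ef →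
    (∀ w, Sum.map id c₃.src (c₄.src (τ.perm w)) =
      swapLeft (Sum.map id c₁.src (c₂.src w))) →
    comp c₄ y (comp c₃ z x) = act τ (comp c₂ z (comp c₁ y x))

namespace StarPolycat

open StarPoly

attribute [instance] StarPolycat.involution

variable {X Y : Set (ℕ × ℕ)}

/-- A functor of `X`-ary `∗`-polycategories: it preserves all the structure strictly. -/
structure Functor (P Q : StarPolycat.{u} X) : Type u where
  obj : P.Obj → Q.Obj
  obj_star : ∀ A, obj (star A) = star (obj A)
  map : ∀ {s : Sequent X P.Obj}, P.Hom s → Q.Hom (s.map obj)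
  map_act : ∀ {s t : Sequent X P.Obj} (σ : SeqIso s t) (x : P.Hom s),
    map (P.act σ x) = Q.act (σ.map obj obj_star) (map x)
  map_one : ∀ {A : P.Obj} {s : Sequent X P.Obj} (i : Ident A s),
    map (P.one i) = Q.one (i.map obj obj_star)
  map_comp : ∀ {g f r : Sequent X P.Obj} (c : Cut g f r) (y : P.Hom g) (x : P.Hom f),
    map (P.comp c y x) = Q.comp (c.map obj obj_star) (map y) (map x)

/-- The category of `X`-ary `∗`-polycategories. -/
instance : Category.{u} (StarPolycat.{u} X) where
  Hom P Q := Functor P Q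
  id _ :=
    { obj := id
      obj_star := fun _ => rfl
      map := fun x => x
      map_act := fun _ _ => rfl
      map_one := fun _ => rfl
      map_comp := fun _ _ _ => rfl }
  comp F G :=
    { obj := G.obj ∘ F.obj
      obj_star := fun A => (congrArg G.obj (F.obj_star A)).trans (G.obj_star _)
      map := fun x => G.map (F.map x)
      map_act := fun σ x =>
        (congrArg (fun y => G.map y) (F.map_act σ x)).trans (G.map_act _ _)
      map_one := fun i => (congrArg (fun y => G.map y) (F.map_one i)).trans (G.map_one _)
      map_comp := fun c y x =>
        (congrArg (fun y => G.map y) (F.map_comp c y x)).trans (G.map_comp _ _ _) }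
  id_comp _ := rfl
  comp_id _ := rfl
  assoc _ _ _ := rfl

/-- The `Y`-ary `∗`-polycategory underlying an `X`-ary one: forget the morphisms whose arity is
not in `Y` and the operations relating to them. -/
def restrict (h : Y ⊆ X) (P : StarPolycat.{u} X) : StarPolycat.{u} Y where
  Obj := P.Obj
  Hom s := P.Hom (s.incl h)
  act σ := P.act (σ.incl h)
  act_refl x := P.act_refl x
  act_trans σ τ x := P.act_trans (σ.incl h) (τ.incl h) x
  one i := P.one (i.incl h)
  act_one i j σ := P.act_one (i.incl h) (j.incl h) (σ.incl h)
  comp c := P.comp (c.incl h)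
  comp_act c c₁ ρ σ τ :=
    P.comp_act (c.incl h) (c₁.incl h) (ρ.incl h) (σ.incl h) (τ.incl h)
  comp_swap c c₁ ρ σ τ :=
    P.comp_swap (c.incl h) (c₁.incl h) (ρ.incl h) (σ.incl h) (τ.incl h)
  one_comp i c τ := P.one_comp (i.incl h) (c.incl h) (τ.incl h)
  comp_one i c τ := P.comp_one (i.incl h) (c.incl h) (τ.incl h)
  assoc c₁ c₂ c₃ c₄ τ :=
    P.assoc (c₁.incl h) (c₂.incl h) (c₃.incl h) (c₄.incl h) (τ.incl h)
  assoc_right c₁ c₂ c₃ c₄ τ :=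
    P.assoc_right (c₁.incl h) (c₂.incl h) (c₃.incl h) (c₄.incl h) (τ.incl h)
  assoc_left c₁ c₂ c₃ c₄ τ :=
    P.assoc_left (c₁.incl h) (c₂.incl h) (c₃.incl h) (c₄.incl h) (τ.incl h)

/-- The forgetful functor from `X`-ary to `Y`-ary `∗`-polycategories, for `Y ⊆ X`. -/
def forget (h : Y ⊆ X) : StarPolycat.{u} X ⥤ StarPolycat.{u} Y where
  obj := restrict h
  map F :=
    { obj := F.obj
      obj_star := F.obj_star
      map := fun x => F.map x
      map_act := fun σ x => F.map_act (σ.incl h) x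
      map_one := fun i => F.map_one (i.incl h)
      map_comp := fun c y x => F.map_comp (c.incl h) y x }
  map_id _ := rfl
  map_comp _ _ := rfl

/-- A functor is bijective on objects. -/
def BijectiveOnObjects {P Q : StarPolycat.{u} X} (F : P ⟶ Q) : Prop :=
  Function.Bijective (Functor.obj F)

/-- A functor is fully faithful except on `(0,0)`-ary morphisms: it is bijective on every set of
morphisms of arity other than `(0,0)`. -/
def FullyFaithfulExceptZero {P Q : StarPolycat.{u} X} (F : P ⟶ Q) : Prop :=
  ∀ s : Sequent X P.Obj, (s.m, s.n) ≠ (0, 0) →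
    Function.Bijective (fun x : P.Hom s => Functor.map F x)

end StarPolycat

/-! A permutation may move an object across the turnstile at the price of a dual, so a morphism type
matters only through its list of places, and the number of outputs is a choice of presentation. The
exception is the empty list, which has only the presentation `(0,0)`. This is why the `(0,0)`-ary
morphisms are the only ones that `U` really loses.

Suppose first that `Y` is `X` without `(0,0)`. A composite is taken along a place of each factor, so
`(0,0)`-ary morphisms can be outputs of a composition but never inputs, and no identity is of this
arity. An extension of `Q` to `X` is therefore just a set `Z` with values in `Z` for the composites
that become empty, compatible with equivariance, symmetry and associativity (`ZeroExt`, `extend`).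
The unit laws add nothing. The one-point `Z` gives the right adjoint. For the left adjoint, `Z`
consists of formal composites, two being identified when they agree under every functor from `Q` to
the restriction of an `X`-ary polycategory. The laws then hold because they hold in each target, and
no list of generating relations is needed. The two adjunctions are `freeAdj` and `terminalAdj`;
restricting either extension gives back `Q`.

In the third case, let `X'` be `X` without `(0,0)`. Every nonempty list can be presented with any
chosen place as its only output (`Sequent.exists_matching_root`), so `X'`-ary and one-output
polycategories are equivalent (`isEquivalence_forget_coUnary`). The quasi-inverse sends `Q` to
compatible families of morphisms over all one-output presentations (`Family`, `complete`). To
compose two families, a surviving place is chosen as the output of the result. The factor containing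
it is the outer one and the other factor is rooted at its cut place, which leaves an ordinary
multicategorical composition. Equivariance and symmetry in `Q` remove the dependence on the choice
(`isComp_of_compat`). Associativity splits according to which of the three morphisms contains the
output. The adjoints for `X'` in `X` are then transported along this equivalence. -/

namespace StarPoly

variable {X Y : Set (ℕ × ℕ)} {O : Type u} [InvolutiveStar O]

/-! ### Restricting arities, and the exceptional arity `(0,0)` -/

/-- A sequent whose arity happens to lie in `Y`, regarded as a `Y`-ary sequent. -/
def Sequent.core {O : Type u} (s : Sequent X O) (hs : (s.m, s.n) ∈ Y) : Sequent Y O :=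
  ⟨s.m, s.n, hs, s.dom, s.cod⟩

def SeqIso.core {s t : Sequent X O} (σ : SeqIso s t) (hs : (s.m, s.n) ∈ Y)
    (ht : (t.m, t.n) ∈ Y) : SeqIso (s.core hs) (t.core ht) :=
  ⟨σ.perm, σ.label_perm⟩

def Ident.core {A : O} {s : Sequent X O} (i : Ident A s) (hs : (s.m, s.n) ∈ Y) :
    Ident A (s.core hs) :=
  ⟨i.pos, i.neg, i.label_pos, i.label_neg, i.shape⟩

def Cut.core {g f r : Sequent X O} (c : Cut g f r) (hg : (g.m, g.n) ∈ Y)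
    (hf : (f.m, f.n) ∈ Y) (hr : (r.m, r.n) ∈ Y) :
    Cut (g.core hg) (f.core hf) (r.core hr) where
  eg := c.eg
  ef := c.ef
  label_cut := c.label_cut
  src := c.src
  label_src := c.label_src
  shape := by
    cases c.shape with
    | m Λ₁ Λ₂ Δ₁ Δ₂ hg hf hd hc => exact .m Λ₁ Λ₂ Δ₁ Δ₂ hg hf hd hc
    | l Λ₁ Λ₂ Γ₁ Γ₂ hg hf hd hc => exact .l Λ₁ Λ₂ Γ₁ Γ₂ hg hf hd hc
    | r S₁ S₂ Δ₁ Δ₂ hg hf hd hc => exact .r S₁ S₂ Δ₁ Δ₂ hg hf hd hc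

def SeqIso.symm {s t : Sequent X O} (σ : SeqIso s t) : SeqIso t s :=
  ⟨σ.perm.symm, fun x => by rw [← σ.label_perm, Equiv.apply_symm_apply]⟩

theorem SeqIso.ext {s t : Sequent X O} {σ τ : SeqIso s t} (h : ∀ x, σ.perm x = τ.perm x) :
    σ = τ := by
  cases σ; cases τ
  congr
  exact Equiv.ext h

/-- `Y` consists of the arities in `X` other than `(0, 0)`. -/
def RemovesZero (X Y : Set (ℕ × ℕ)) : Prop := ∀ p, p ∈ Y ↔ p ∈ X ∧ p ≠ (0, 0)

namespace RemovesZero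

theorem le (H : RemovesZero X Y) : Y ⊆ X := fun p hp => ((H p).1 hp).1

/-- Every cut exhibits a place of each of its two factors, and every identity exhibits a place of
its type. Through this lemma all factors and all identities already live in `Y`. -/
theorem mem_of_entry {O : Type u} (H : RemovesZero X Y) (s : Sequent X O) (e : s.Entry) :
    (s.m, s.n) ∈ Y := by
  refine (H _).2 ⟨s.mem, fun h => ?_⟩
  obtain ⟨h1, h2⟩ := Prod.mk.inj h
  rcases e with i | i
  · exact absurd i.2 (by omega)
  · exact absurd i.2 (by omega)

theorem entry_of_mem {O : Type u} (H : RemovesZero X Y) (s : Sequent X O)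
    (hs : (s.m, s.n) ∈ Y) : Nonempty s.Entry := by
  have h := ((H _).1 hs).2
  by_cases hm : s.m = 0
  · exact ⟨.inr ⟨0, Nat.pos_of_ne_zero fun hn => h (by rw [hm, hn])⟩⟩
  · exact ⟨.inl ⟨0, Nat.pos_of_ne_zero hm⟩⟩

theorem isEmpty (H : RemovesZero X Y) {O : Type u} {s : Sequent X O} (hs : (s.m, s.n) ∉ Y) :
    IsEmpty s.Entry := ⟨fun e => hs (H.mem_of_entry s e)⟩

theorem mem_iff (H : RemovesZero X Y) {s t : Sequent X O} (σ : SeqIso s t) :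
    (s.m, s.n) ∈ Y ↔ (t.m, t.n) ∈ Y :=
  ⟨fun h => let ⟨e⟩ := H.entry_of_mem s h; H.mem_of_entry t (σ.perm e),
   fun h => let ⟨e⟩ := H.entry_of_mem t h; H.mem_of_entry s (σ.perm.symm e)⟩

/-- The only isomorphism between two empty lists. -/
def isoOfZero (H : RemovesZero X Y) {s t : Sequent X O} (hs : (s.m, s.n) ∉ Y)
    (ht : (t.m, t.n) ∉ Y) : SeqIso s t :=
  haveI := H.isEmpty hs
  haveI := H.isEmpty ht
  ⟨Equiv.equivOfIsEmpty _ _, fun x => isEmptyElim x⟩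

theorem iso_unique (H : RemovesZero X Y) {s t : Sequent X O} (hs : (s.m, s.n) ∉ Y)
    (σ τ : SeqIso s t) : σ = τ :=
  SeqIso.ext fun x => ((H.isEmpty hs).false x).elim

end RemovesZero

end StarPoly

/-! ### Adjoining `(0,0)`-ary morphisms -/

namespace StarPolycat

open StarPoly

variable {X Y : Set (ℕ × ℕ)}

/-- A choice of `(0,0)`-ary morphisms extending a polycategory `Q` that has none: a set `Z`, and
composites in `Z` of the pairs of morphisms of `Q` whose composite is `(0,0)`-ary. -/
structure ZeroExt (Q : StarPolycat.{u} Y) (h : Y ⊆ X) : Type (u + 1) where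
  -- One set serves for all empty sequents, since between any two of them there is exactly one
  -- permutation.
  Z : Type u
  pair : ∀ {g f : Sequent Y Q.Obj} {r : Sequent X Q.Obj}, Cut (g.incl h) (f.incl h) r →
    (r.m, r.n) ∉ Y → Q.Hom g → Q.Hom f → Z
  pair_act : ∀ {g f g₁ f₁ : Sequent Y Q.Obj} {r r₁ : Sequent X Q.Obj}
    (c : Cut (g.incl h) (f.incl h) r) (c₁ : Cut (g₁.incl h) (f₁.incl h) r₁)
    (hr : (r.m, r.n) ∉ Y) (hr₁ : (r₁.m, r₁.n) ∉ Y)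
    (ρ : SeqIso g g₁) (σ : SeqIso f f₁) (τ : SeqIso r r₁) (y : Q.Hom g) (x : Q.Hom f),
    ρ.perm c.eg = c₁.eg → σ.perm c.ef = c₁.ef →
    (∀ z, c₁.src (τ.perm z) = Sum.map ρ.perm σ.perm (c.src z)) →
    pair c₁ hr₁ (Q.act ρ y) (Q.act σ x) = pair c hr y x
  pair_swap : ∀ {g f g₁ f₁ : Sequent Y Q.Obj} {r r₁ : Sequent X Q.Obj}
    (c : Cut (g.incl h) (f.incl h) r) (c₁ : Cut (f₁.incl h) (g₁.incl h) r₁)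
    (hr : (r.m, r.n) ∉ Y) (hr₁ : (r₁.m, r₁.n) ∉ Y)
    (ρ : SeqIso g g₁) (σ : SeqIso f f₁) (τ : SeqIso r r₁) (y : Q.Hom g) (x : Q.Hom f),
    ρ.perm c.eg = c₁.ef → σ.perm c.ef = c₁.eg →
    (∀ z, c₁.src (τ.perm z) = (Sum.map ρ.perm σ.perm (c.src z)).swap) →
    pair c₁ hr₁ (Q.act σ x) (Q.act ρ y) = pair c hr y x
  pair_assoc : ∀ {k g f u v : Sequent Y Q.Obj} {r r₁ : Sequent X Q.Obj}
    (c₁ : Cut k g u) (c₂ : Cut (u.incl h) (f.incl h) r)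
    (c₃ : Cut g f v) (c₄ : Cut (k.incl h) (v.incl h) r₁) (hr : (r.m, r.n) ∉ Y)
    (hr₁ : (r₁.m, r₁.n) ∉ Y) (τ : SeqIso r r₁) (z : Q.Hom k) (y : Q.Hom g) (x : Q.Hom f),
    c₄.eg = c₁.eg → c₃.src c₄.ef = .inl c₁.ef →
    c₁.src c₂.eg = .inr c₃.eg → c₂.ef = c₃.ef →
    (∀ w, Sum.map id c₃.src (c₄.src (τ.perm w)) =
      Equiv.sumAssoc _ _ _ (Sum.map c₁.src id (c₂.src w))) →
    pair c₄ hr₁ z (Q.comp c₃ y x) = pair c₂ hr (Q.comp c₁ z y) x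
  pair_assoc_right : ∀ {k g f u v : Sequent Y Q.Obj} {r r₁ : Sequent X Q.Obj}
    (c₁ : Cut k g u) (c₂ : Cut (u.incl h) (f.incl h) r)
    (c₃ : Cut k f v) (c₄ : Cut (v.incl h) (g.incl h) r₁) (hr : (r.m, r.n) ∉ Y)
    (hr₁ : (r₁.m, r₁.n) ∉ Y) (τ : SeqIso r r₁) (z : Q.Hom k) (y : Q.Hom g) (x : Q.Hom f),
    c₃.src c₄.eg = .inl c₁.eg → c₄.ef = c₁.ef →
    c₁.src c₂.eg = .inl c₃.eg → c₂.ef = c₃.ef →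
    (∀ w, Sum.map c₃.src id (c₄.src (τ.perm w)) =
      swapRight (Sum.map c₁.src id (c₂.src w))) →
    pair c₄ hr₁ (Q.comp c₃ z x) y = pair c₂ hr (Q.comp c₁ z y) x
  pair_assoc_left : ∀ {k g f u v : Sequent Y Q.Obj} {r r₁ : Sequent X Q.Obj}
    (c₁ : Cut g f u) (c₂ : Cut (k.incl h) (u.incl h) r)
    (c₃ : Cut k f v) (c₄ : Cut (g.incl h) (v.incl h) r₁) (hr : (r.m, r.n) ∉ Y)
    (hr₁ : (r₁.m, r₁.n) ∉ Y) (τ : SeqIso r r₁) (z : Q.Hom k) (y : Q.Hom g) (x : Q.Hom f),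
    c₄.eg = c₁.eg → c₃.src c₄.ef = .inr c₁.ef →
    c₂.eg = c₃.eg → c₁.src c₂.ef = .inr c₃.ef →
    (∀ w, Sum.map id c₃.src (c₄.src (τ.perm w)) =
      swapLeft (Sum.map id c₁.src (c₂.src w))) →
    pair c₄ hr₁ y (Q.comp c₃ z x) = pair c₂ hr z (Q.comp c₁ y x)

/-- Morphisms of the polycategory obtained by adjoining `(0,0)`-ary morphisms. -/
@[ext]
structure ExtHom (Q : StarPolycat.{u} Y) {h : Y ⊆ X} (D : ZeroExt Q h) (s : Sequent X Q.Obj) :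
    Type u where
  val : (hs : (s.m, s.n) ∈ Y) → Q.Hom (s.core hs)
  zero : (s.m, s.n) ∉ Y → D.Z

set_option linter.unusedVariables false in
/-- Adjoin `(0,0)`-ary morphisms to a polycategory that has none. -/
def extend (H : RemovesZero X Y) {h : Y ⊆ X} (Q : StarPolycat.{u} Y) (D : ZeroExt Q h) :
    StarPolycat.{u} X where
  Obj := Q.Obj
  -- Exactly one of the two components of such a morphism carries data, so each law below can be
  -- checked separately for nonempty and empty results, without transport.
  Hom := ExtHom Q D
  act σ x := ⟨fun ht => Q.act (σ.core ((H.mem_iff σ).2 ht) ht) (x.val _),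
    fun ht => x.zero fun hs => ht ((H.mem_iff σ).1 hs)⟩
  act_refl x := ExtHom.ext (funext fun _ => Q.act_refl _) rfl
  act_trans σ τ x := ExtHom.ext
    (funext fun ht => Q.act_trans (σ.core _ ((H.mem_iff τ).2 ht)) (τ.core _ ht) _) rfl
  one i := ⟨fun hs => Q.one (i.core hs), fun hs => (hs (H.mem_of_entry _ i.pos)).elim⟩
  act_one i j σ h₁ h₂ := ExtHom.ext (funext fun _ => Q.act_one _ _ _ h₁ h₂)
    (funext fun ht => (ht (H.mem_of_entry _ j.pos)).elim)
  comp {g f r} c y x :=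
    have hg := H.mem_of_entry g c.eg
    have hf := H.mem_of_entry f c.ef
    ⟨fun hr => Q.comp (c.core hg hf hr) (y.val hg) (x.val hf),
     fun hr => D.pair (g := g.core hg) (f := f.core hf) c hr (y.val hg) (x.val hf)⟩
  comp_act c c₁ ρ σ τ y x h₁ h₂ h₃ := ExtHom.ext
    (funext fun ht => Q.comp_act _ _ _ _ _ _ _ h₁ h₂ h₃)
    (funext fun ht => D.pair_act _ _ _ _ _ _ τ _ _ h₁ h₂ h₃)
  comp_swap c c₁ ρ σ τ y x h₁ h₂ h₃ := ExtHom.ext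
    (funext fun ht => Q.comp_swap _ _ _ _ _ _ _ h₁ h₂ h₃)
    (funext fun ht => D.pair_swap _ _ _ _ _ _ τ _ _ h₁ h₂ h₃)
  one_comp i c τ x h₁ h₂ := ExtHom.ext
    (funext fun ht => Q.one_comp _ _ _ _ h₁ h₂)
    -- The result of a unit law has the type of `x`, which contains the cut place and so is not
    -- empty.
    (funext fun ht => (ht (H.mem_of_entry _ c.ef)).elim)
  comp_one i c τ x h₁ h₂ := ExtHom.ext
    (funext fun ht => Q.comp_one _ _ _ _ h₁ h₂)
    (funext fun ht => (ht (H.mem_of_entry _ c.eg)).elim)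
  assoc {k g f u r v r₁} c₁ c₂ c₃ c₄ τ z y x h₁ h₂ h₃ h₄ h₅ :=
    -- The intermediate composites are cut again, so they too have a place; only the final composite
    -- can be empty.
    have hu := H.mem_of_entry u c₂.eg
    have hv := H.mem_of_entry v c₄.ef
    have hk := H.mem_of_entry k c₁.eg
    have hg := H.mem_of_entry g c₁.ef
    have hf := H.mem_of_entry f c₂.ef
    ExtHom.ext
    (funext fun ht => Q.assoc (c₁.core hk hg hu) (c₂.core hu hf ((H.mem_iff τ).2 ht))
      (c₃.core hg hf hv) (c₄.core hk hv ht) (τ.core _ ht) _ _ _ h₁ h₂ h₃ h₄ h₅)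
    (funext fun ht => D.pair_assoc (c₁.core hk hg hu) _ (c₃.core hg hf hv) _ _ _ τ _ _ _
      h₁ h₂ h₃ h₄ h₅)
  assoc_right {k g f u r v r₁} c₁ c₂ c₃ c₄ τ z y x h₁ h₂ h₃ h₄ h₅ :=
    have hu := H.mem_of_entry u c₂.eg
    have hv := H.mem_of_entry v c₄.eg
    have hk := H.mem_of_entry k c₁.eg
    have hg := H.mem_of_entry g c₁.ef
    have hf := H.mem_of_entry f c₂.ef
    ExtHom.ext
    (funext fun ht => Q.assoc_right (c₁.core hk hg hu) (c₂.core hu hf ((H.mem_iff τ).2 ht))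
      (c₃.core hk hf hv) (c₄.core hv hg ht) (τ.core _ ht) _ _ _ h₁ h₂ h₃ h₄ h₅)
    (funext fun ht => D.pair_assoc_right (c₁.core hk hg hu) _ (c₃.core hk hf hv) _ _ _ τ _ _ _
      h₁ h₂ h₃ h₄ h₅)
  assoc_left {k g f u r v r₁} c₁ c₂ c₃ c₄ τ z y x h₁ h₂ h₃ h₄ h₅ :=
    have hu := H.mem_of_entry u c₂.ef
    have hv := H.mem_of_entry v c₄.ef
    have hk := H.mem_of_entry k c₂.eg
    have hg := H.mem_of_entry g c₁.eg
    have hf := H.mem_of_entry f c₁.ef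
    ExtHom.ext
    (funext fun ht => Q.assoc_left (c₁.core hg hf hu) (c₂.core hk hu ((H.mem_iff τ).2 ht))
      (c₃.core hk hf hv) (c₄.core hg hv ht) (τ.core _ ht) _ _ _ h₁ h₂ h₃ h₄ h₅)
    (funext fun ht => D.pair_assoc_left (c₁.core hg hf hu) _ (c₃.core hk hf hv) _ _ _ τ _ _ _
      h₁ h₂ h₃ h₄ h₅)

end StarPolycat

/-! ### Extensionality of functors, and what isomorphisms preserve -/

namespace StarPolycat

open StarPoly

variable {X Y : Set (ℕ × ℕ)}

theorem Functor.ext_map {P Q : StarPolycat.{u} X} {F G : Functor P Q} (h : F.obj = G.obj)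
    (hm : ∀ (s : Sequent X P.Obj) (x : P.Hom s), HEq (F.map x) (G.map x)) : F = G := by
  obtain ⟨o, h1, m, h2, h3, h4⟩ := F
  obtain ⟨o', h1', m', h2', h3', h4'⟩ := G
  obtain rfl : o = o' := h
  obtain rfl : @m = @m' := by
    funext s x
    exact eq_of_heq (hm s x)
  rfl

theorem Functor.map_heq {P Q : StarPolycat.{u} X} {F G : Functor P Q} (h : F = G)
    {s : Sequent X P.Obj} (x : P.Hom s) : HEq (F.map x) (G.map x) := by
  subst h; rfl

theorem Functor.map_bijective_of_eq_id {P : StarPolycat.{u} X} {F : P ⟶ P} (h : F = 𝟙 P)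
    (s : Sequent X P.Obj) : Function.Bijective (fun x : P.Hom s => Functor.map F x) := by
  subst h
  exact Function.bijective_id

theorem bijectiveOnObjects_of_isIso {P Q : StarPolycat.{u} X} (F : P ⟶ Q) [IsIso F] :
    BijectiveOnObjects F :=
  Function.bijective_iff_has_inverse.2 ⟨Functor.obj (inv F),
    congrFun (congrArg Functor.obj (IsIso.hom_inv_id F)),
    congrFun (congrArg Functor.obj (IsIso.inv_hom_id F))⟩

theorem map_bijective_of_isIso {P Q : StarPolycat.{u} X} (F : P ⟶ Q) [IsIso F]
    (s : Sequent X P.Obj) : Function.Bijective (fun x : P.Hom s => Functor.map F x) := by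
  have h1 := Functor.map_bijective_of_eq_id (IsIso.hom_inv_id F) s
  have h2 := Functor.map_bijective_of_eq_id (IsIso.inv_hom_id F) (s.map (Functor.obj F))
  -- The inverse functor is injective here because applying `F` after it is bijective, and
  -- surjective because applying `F` before it is bijective. This avoids transport along the
  -- equality of objects.
  have h3 : Function.Bijective
      (fun y : Q.Hom (s.map (Functor.obj F)) => Functor.map (inv F) y) :=
    ⟨Function.Injective.of_comp (f := fun z => Functor.map F z) h2.1,
      Function.Surjective.of_comp (g := fun z => Functor.map F z) h1.2⟩
  exact (Function.Bijective.of_comp_iff' h3 _).1 h1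

theorem fullyFaithfulExceptZero_of_isIso {P Q : StarPolycat.{u} X} (F : P ⟶ Q) [IsIso F] :
    FullyFaithfulExceptZero F := fun s _ => map_bijective_of_isIso F s

theorem BijectiveOnObjects.comp {P Q R : StarPolycat.{u} X} {F : P ⟶ Q} {G : Q ⟶ R}
    (hF : BijectiveOnObjects F) (hG : BijectiveOnObjects G) : BijectiveOnObjects (F ≫ G) :=
  show Function.Bijective (Functor.obj G ∘ Functor.obj F) from Function.Bijective.comp hG hF

theorem FullyFaithfulExceptZero.comp {P Q R : StarPolycat.{u} X} {F : P ⟶ Q} {G : Q ⟶ R}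
    (hF : FullyFaithfulExceptZero F) (hG : FullyFaithfulExceptZero G) :
    FullyFaithfulExceptZero (F ≫ G) :=
  fun s hs =>
    show Function.Bijective ((fun x => Functor.map G x) ∘ fun x => Functor.map F x) from
      Function.Bijective.comp (hG (s.map (Functor.obj F)) hs) (hF s hs)

/-! ### The two adjoints when only `(0,0)` is removed -/

section Adjoints

variable (H : RemovesZero X Y) {h : Y ⊆ X}

/-- The projection from the restriction of an extension to the original polycategory. -/
def extendProj (Q : StarPolycat.{u} Y) (D : ZeroExt Q h) :
    (forget h).obj (extend H Q D) ⟶ Q where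
  obj := id
  obj_star _ := rfl
  map {s} x := x.val s.mem
  map_act _ _ := rfl
  map_one _ := rfl
  map_comp _ _ _ := rfl

/-- The inclusion of a polycategory into the restriction of its extension. -/
def extendIncl (Q : StarPolycat.{u} Y) (D : ZeroExt Q h) :
    Q ⟶ (forget h).obj (extend H Q D) where
  obj := id
  obj_star _ := rfl
  map {s} x := ⟨fun _ => x, fun hs => (hs s.mem).elim⟩
  map_act {s t} σ x := ExtHom.ext rfl (funext fun ht => (ht t.mem).elim)
  map_one {A s} i := ExtHom.ext rfl (funext fun ht => (ht s.mem).elim)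
  map_comp {g f r} c y x := ExtHom.ext rfl (funext fun ht => (ht r.mem).elim)

theorem extendHom_ext {Q : StarPolycat.{u} Y} {D : ZeroExt Q h} {s : Sequent Y Q.Obj}
    {x y : ExtHom Q D (s.incl h)} (hxy : x.val s.mem = y.val s.mem) : x = y :=
  ExtHom.ext (funext fun _ => hxy) (funext fun hs => (hs s.mem).elim)

/-- Restricting an extension recovers the original polycategory. -/
def extendIso (Q : StarPolycat.{u} Y) (D : ZeroExt Q h) :
    Q ≅ (forget h).obj (extend H Q D) where
  hom := extendIncl H Q D
  inv := extendProj H Q D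
  hom_inv_id := rfl
  inv_hom_id := Functor.ext_map rfl fun _ _ => heq_of_eq (extendHom_ext rfl)

/-- The extension by a single `(0,0)`-ary morphism. -/
def terminalExt (Q : StarPolycat.{u} Y) (h : Y ⊆ X) : ZeroExt Q h where
  Z := PUnit
  pair _ _ _ _ := ⟨⟩
  pair_act _ _ _ _ _ _ _ _ _ _ _ _ := rfl
  pair_swap _ _ _ _ _ _ _ _ _ _ _ _ := rfl
  pair_assoc _ _ _ _ _ _ _ _ _ _ _ _ _ _ _ := rfl
  pair_assoc_right _ _ _ _ _ _ _ _ _ _ _ _ _ _ _ := rfl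
  pair_assoc_left _ _ _ _ _ _ _ _ _ _ _ _ _ _ _ := rfl

/-- The functor into the extension by one `(0,0)`-ary morphism determined by its restriction. -/
def toTerminal {P : StarPolycat.{u} X} {Q : StarPolycat.{u} Y} (F : Functor (restrict h P) Q) :
    P ⟶ extend H Q (terminalExt Q h) where
  obj := F.obj
  obj_star := F.obj_star
  map {s} x := ⟨fun hs => F.map (s := s.core hs) x, fun _ => ⟨⟩⟩
  map_act {s t} σ x := ExtHom.ext
    (funext fun ht => F.map_act (σ.core ((H.mem_iff σ).2 ht) ht) x) rfl
  map_one {A s} i := ExtHom.ext (funext fun hs => F.map_one (i.core hs))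
    (funext fun _ => rfl)
  map_comp {g f r} c y x := ExtHom.ext
    (funext fun hr => F.map_comp
      (c.core (H.mem_of_entry g c.eg) (H.mem_of_entry f c.ef) hr) y x) rfl

/-- A pair of morphisms with a `(0,0)`-ary composite. -/
structure ZeroPair (Q : StarPolycat.{u} Y) (h : Y ⊆ X) : Type u where
  {g f : Sequent Y Q.Obj}
  {r : Sequent X Q.Obj}
  cut : Cut (g.incl h) (f.incl h) r
  hr : (r.m, r.n) ∉ Y
  left : Q.Hom g
  right : Q.Hom f

/-- The composite of such a pair in a polycategory `P` that `Q` is mapped to. -/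
def ZeroPair.eval {Q : StarPolycat.{u} Y} (p : ZeroPair Q h) {P : StarPolycat.{u} X}
    (F : Functor Q (restrict h P)) : P.Hom (p.r.map (F.obj)) :=
  P.comp (p.cut.map (F.obj) (F.obj_star)) (F.map p.left)
    (F.map p.right)

/-- Two pairs are identified if their composites agree in every polycategory. -/
def ZeroPair.Rel {Q : StarPolycat.{u} Y} (p q : ZeroPair Q h) : Prop :=
  ∀ (P : StarPolycat.{u} X) (F : Functor Q (restrict h P)) (τ : SeqIso p.r q.r),
    q.eval F = P.act (τ.map (F.obj) (F.obj_star)) (p.eval F)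

set_option linter.unusedVariables false in
/-- The free `(0,0)`-ary morphisms: formal composites of pairs. -/
def freeExt (H : RemovesZero X Y) (Q : StarPolycat.{u} Y) (h : Y ⊆ X) : ZeroExt Q h where
  Z := Quot (ZeroPair.Rel (Q := Q) (h := h))
  pair c hr y x := Quot.mk _ ⟨c, hr, y, x⟩
  -- Each law of the formal composites is the same law of the target `P`: `F` preserves the
  -- operations, and the permutation between empty sequents is forced.
  pair_act {g f g₁ f₁ r r₁} c c₁ hr hr₁ ρ σ τ y x h₁ h₂ h₃ := (Quot.sound fun P F τ' => by
    obtain rfl := H.iso_unique hr τ τ'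
    simp only [ZeroPair.eval, F.map_act]
    exact P.comp_act (c.map (F.obj) (F.obj_star))
      (c₁.map (F.obj) (F.obj_star)) _ _ _ _ _ h₁ h₂ h₃).symm
  pair_swap {g f g₁ f₁ r r₁} c c₁ hr hr₁ ρ σ τ y x h₁ h₂ h₃ := (Quot.sound fun P F τ' => by
    obtain rfl := H.iso_unique hr τ τ'
    simp only [ZeroPair.eval, F.map_act]
    exact P.comp_swap (c.map (F.obj) (F.obj_star))
      (c₁.map (F.obj) (F.obj_star)) _ _ _ _ _ h₁ h₂ h₃).symm
  pair_assoc {k g f u v r r₁} c₁ c₂ c₃ c₄ hr hr₁ τ z y x h₁ h₂ h₃ h₄ h₅ :=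
    (Quot.sound fun P F τ' => by
    obtain rfl := H.iso_unique hr τ τ'
    simp only [ZeroPair.eval, F.map_comp]
    exact P.assoc ((c₁.map (F.obj) (F.obj_star)).incl h)
      (c₂.map (F.obj) (F.obj_star))
      ((c₃.map (F.obj) (F.obj_star)).incl h)
      (c₄.map (F.obj) (F.obj_star)) _ _ _ _ h₁ h₂ h₃ h₄ h₅).symm
  pair_assoc_right {k g f u v r r₁} c₁ c₂ c₃ c₄ hr hr₁ τ z y x h₁ h₂ h₃ h₄ h₅ :=
    (Quot.sound fun P F τ' => by
    obtain rfl := H.iso_unique hr τ τ'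
    simp only [ZeroPair.eval, F.map_comp]
    exact P.assoc_right ((c₁.map (F.obj) (F.obj_star)).incl h)
      (c₂.map (F.obj) (F.obj_star))
      ((c₃.map (F.obj) (F.obj_star)).incl h)
      (c₄.map (F.obj) (F.obj_star)) _ _ _ _ h₁ h₂ h₃ h₄ h₅).symm
  pair_assoc_left {k g f u v r r₁} c₁ c₂ c₃ c₄ hr hr₁ τ z y x h₁ h₂ h₃ h₄ h₅ :=
    (Quot.sound fun P F τ' => by
    obtain rfl := H.iso_unique hr τ τ'
    simp only [ZeroPair.eval, F.map_comp]
    exact P.assoc_left ((c₁.map (F.obj) (F.obj_star)).incl h)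
      (c₂.map (F.obj) (F.obj_star))
      ((c₃.map (F.obj) (F.obj_star)).incl h)
      (c₄.map (F.obj) (F.obj_star)) _ _ _ _ h₁ h₂ h₃ h₄ h₅).symm

/-- The interpretation of a free `(0,0)`-ary morphism. -/
def evalZero {P : StarPolycat.{u} X} {Q : StarPolycat.{u} Y} (F : Functor Q (restrict h P))
    {s : Sequent X Q.Obj} (hs : (s.m, s.n) ∉ Y) :
    Quot (ZeroPair.Rel (Q := Q) (h := h)) → P.Hom (s.map F.obj) :=
  Quot.lift (fun p => P.act ((H.isoOfZero p.hr hs).map F.obj F.obj_star)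
    (p.eval F)) fun p q hpq => by
      refine Eq.trans ?_ (congrArg (P.act ((H.isoOfZero q.hr hs).map F.obj F.obj_star))
        (hpq P F (H.isoOfZero p.hr q.hr))).symm
      refine Eq.trans ?_ (P.act_trans _ _ _)
      exact congrArg (fun σ => P.act (SeqIso.map _ F.obj_star σ) (p.eval F))
        (H.iso_unique p.hr _ ((H.isoOfZero p.hr q.hr).trans (H.isoOfZero q.hr hs)))

theorem act_evalZero {P : StarPolycat.{u} X} {Q : StarPolycat.{u} Y}
    (F : Functor Q (restrict h P)) {s t : Sequent X Q.Obj} (hs : (s.m, s.n) ∉ Y)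
    (ht : (t.m, t.n) ∉ Y) (σ : SeqIso s t) (z : Quot (ZeroPair.Rel (Q := Q) (h := h))) :
    evalZero H F ht z = P.act (σ.map F.obj F.obj_star) (evalZero H F hs z) := by
  obtain ⟨p, rfl⟩ := Quot.exists_rep z
  refine Eq.trans ?_ (P.act_trans _ _ _)
  exact congrArg (fun σ => P.act (SeqIso.map _ F.obj_star σ) (p.eval F))
    (H.iso_unique p.hr _ ((H.isoOfZero p.hr hs).trans σ))

theorem evalZero_mk {P : StarPolycat.{u} X} {Q : StarPolycat.{u} Y}
    (F : Functor Q (restrict h P)) (p : ZeroPair Q h) :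
    evalZero H F p.hr (Quot.mk _ p) = p.eval F := by
  refine Eq.trans ?_ (P.act_refl _)
  exact congrArg (fun σ => P.act (SeqIso.map _ F.obj_star σ) (p.eval F))
    (H.iso_unique p.hr _ (SeqIso.refl p.r))

open Classical in
/-- The action on morphisms of the functor `ofFree`. -/
noncomputable def ofFreeMap {P : StarPolycat.{u} X} {Q : StarPolycat.{u} Y}
    (F : Functor Q (restrict h P)) {s : Sequent X Q.Obj} (x : ExtHom Q (freeExt H Q h) s) :
    P.Hom (s.map F.obj) :=
  if hs : (s.m, s.n) ∈ Y then F.map (x.val hs) else evalZero H F hs (x.zero hs)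

theorem ofFreeMap_of_mem {P : StarPolycat.{u} X} {Q : StarPolycat.{u} Y}
    (F : Functor Q (restrict h P)) {s : Sequent X Q.Obj} (hs : (s.m, s.n) ∈ Y)
    (x : ExtHom Q (freeExt H Q h) s) : ofFreeMap H F x = F.map (x.val hs) :=
  dif_pos hs

theorem ofFreeMap_of_notMem {P : StarPolycat.{u} X} {Q : StarPolycat.{u} Y}
    (F : Functor Q (restrict h P)) {s : Sequent X Q.Obj} (hs : (s.m, s.n) ∉ Y)
    (x : ExtHom Q (freeExt H Q h) s) : ofFreeMap H F x = evalZero H F hs (x.zero hs) :=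
  dif_neg hs

/-- The functor out of the free extension determined by its restriction. -/
noncomputable def ofFree {P : StarPolycat.{u} X} {Q : StarPolycat.{u} Y}
    (F : Functor Q (restrict h P)) : Functor (extend H Q (freeExt H Q h)) P where
  obj := F.obj
  obj_star := F.obj_star
  map x := ofFreeMap H F x
  map_act {s t} σ x := by
    by_cases ht : (t.m, t.n) ∈ Y
    · have hs := (H.mem_iff σ).2 ht
      exact (ofFreeMap_of_mem H F ht _).trans ((F.map_act (σ.core hs ht) _).trans
        (congrArg (P.act _) (ofFreeMap_of_mem H F hs _).symm))
    · have hs := fun hs => ht ((H.mem_iff σ).1 hs)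
      exact (ofFreeMap_of_notMem H F ht _).trans ((act_evalZero H F hs ht σ _).trans
        (congrArg (P.act _) (ofFreeMap_of_notMem H F hs _).symm))
  map_one {A s} i := by
    have hs := H.mem_of_entry s i.pos
    exact (ofFreeMap_of_mem H F hs _).trans (F.map_one (i.core hs))
  map_comp {g f r} c y x := by
    have hg := H.mem_of_entry g c.eg
    have hf := H.mem_of_entry f c.ef
    refine Eq.trans ?_ (congrArg₂ (P.comp (c.map F.obj F.obj_star))
      (ofFreeMap_of_mem H F hg y).symm (ofFreeMap_of_mem H F hf x).symm)
    by_cases hr : (r.m, r.n) ∈ Y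
    · exact (ofFreeMap_of_mem H F hr _).trans (F.map_comp (c.core hg hf hr) _ _)
    · exact (ofFreeMap_of_notMem H F hr _).trans
        (evalZero_mk H F
          { g := g.core hg, f := f.core hf, cut := c, hr := hr, left := y.val hg
            right := x.val hf })

/-- The universal property of the free extension. -/
noncomputable def freeEquiv (Q : StarPolycat.{u} Y) (P : StarPolycat.{u} X) :
    (extend H Q (freeExt H Q h) ⟶ P) ≃ (Q ⟶ (forget h).obj P) where
  toFun G := extendIncl H Q _ ≫ (forget h).map G
  invFun F := ofFree H F
  left_inv G := by
    refine Functor.ext_map rfl fun s x => heq_of_eq ?_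
    by_cases hs : (s.m, s.n) ∈ Y
    · refine (ofFreeMap_of_mem H _ hs x).trans ?_
      exact congrArg (fun z => Functor.map G z) (extendHom_ext (Q := Q) (D := freeExt H Q h)
        (s := Sequent.core (Y := Y) s hs) (y := x) rfl)
    · refine (ofFreeMap_of_notMem H _ hs x).trans ?_
      -- Uniqueness: up to the trivial permutation of empty lists, a `(0,0)`-ary morphism of the
      -- free extension is a composite of two morphisms of `Q`, on which `G` is already known.
      obtain ⟨p, hp⟩ := Quot.exists_rep (x.zero hs)
      let y : ExtHom Q (freeExt H Q h) (p.g.incl h) := ⟨fun _ => p.left, fun hs => (hs p.g.mem).elim⟩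
      let z : ExtHom Q (freeExt H Q h) (p.f.incl h) := ⟨fun _ => p.right, fun hs => (hs p.f.mem).elim⟩
      have hx : (extend H Q (freeExt H Q h)).act (H.isoOfZero p.hr hs)
          ((extend H Q (freeExt H Q h)).comp p.cut y z) = x :=
        ExtHom.ext (funext fun hs' => (hs hs').elim) (funext fun _ => hp)
      refine (congrArg _ hp.symm).trans (Eq.trans ?_ (congrArg (fun z => Functor.map G z) hx))
      refine Eq.trans ?_ (Functor.map_act G _ _).symm
      exact congrArg (P.act _) (Functor.map_comp G _ _ _).symm
  right_inv F := Functor.ext_map rfl fun s x => heq_of_eq (ofFreeMap_of_mem H F s.mem _)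

/-- The universal property of the extension by one `(0,0)`-ary morphism. -/
def terminalEquiv (P : StarPolycat.{u} X) (Q : StarPolycat.{u} Y) :
    ((forget h).obj P ⟶ Q) ≃ (P ⟶ extend H Q (terminalExt Q h)) where
  toFun F := toTerminal H F
  invFun G := (forget h).map G ≫ extendProj H Q _
  left_inv F := rfl
  -- The one-point component carries no information, so `G` is determined by its values on nonempty
  -- sequents.
  right_inv G := rfl

/-- The left adjoint of the forgetful functor. -/
noncomputable def freeFunctor (h : Y ⊆ X) : StarPolycat.{u} Y ⥤ StarPolycat.{u} X :=
  Adjunction.leftAdjointOfEquiv (G := forget h) (freeEquiv H) fun _ _ _ _ _ => rfl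

noncomputable def freeAdj (h : Y ⊆ X) : freeFunctor.{u} H h ⊣ forget h :=
  Adjunction.adjunctionOfEquivLeft _ _

/-- The right adjoint of the forgetful functor. -/
def terminalFunctor (h : Y ⊆ X) : StarPolycat.{u} Y ⥤ StarPolycat.{u} X :=
  Adjunction.rightAdjointOfEquiv (F := forget h) (terminalEquiv H) fun _ _ _ _ _ => rfl

def terminalAdj (h : Y ⊆ X) : forget.{u} h ⊣ terminalFunctor.{u} H h :=
  Adjunction.adjunctionOfEquivRight _ _

theorem freeAdj_unit_app (Q : StarPolycat.{u} Y) :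
    (freeAdj H h).unit.app Q = (extendIso H Q (freeExt H Q h)).hom := by
  simp [freeAdj]
  rfl

theorem terminalAdj_counit_app (Q : StarPolycat.{u} Y) :
    (terminalAdj H h).counit.app Q = (extendIso H Q (terminalExt Q h)).inv := by
  simp [terminalAdj]
  rfl

theorem freeAdj_counit_app (P : StarPolycat.{u} X) :
    (freeAdj H h).counit.app P = ofFree H (𝟙 (restrict h P)) := by
  simp [freeAdj]
  rfl

theorem terminalAdj_unit_app (P : StarPolycat.{u} X) :
    (terminalAdj H h).unit.app P = toTerminal H (𝟙 (restrict h P)) := by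
  simp [terminalAdj]
  rfl

theorem isIso_freeAdj_unit : IsIso (freeAdj.{u} H h).unit := by
  have : ∀ Q, IsIso ((freeAdj.{u} H h).unit.app Q) := fun Q => by
    rw [freeAdj_unit_app]; exact (extendIso H Q _).isIso_hom
  exact NatIso.isIso_of_isIso_app _

theorem isIso_terminalAdj_counit : IsIso (terminalAdj.{u} H h).counit := by
  have : ∀ Q, IsIso ((terminalAdj.{u} H h).counit.app Q) := fun Q => by
    rw [terminalAdj_counit_app]; exact (extendIso H Q _).isIso_inv
  exact NatIso.isIso_of_isIso_app _

theorem ext_val_bijective {Q : StarPolycat.{u} Y} (D : ZeroExt Q h) {s : Sequent X Q.Obj}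
    (hs : (s.m, s.n) ∈ Y) : Function.Bijective (fun x : ExtHom Q D s => x.val hs) :=
  ⟨fun _ _ hxy => extendHom_ext (s := s.core hs) hxy,
    fun x => ⟨⟨fun _ => x, fun h => (h hs).elim⟩, rfl⟩⟩

theorem freeAdj_counit_spec (P : StarPolycat.{u} X) :
    BijectiveOnObjects ((freeAdj H h).counit.app P) ∧
      FullyFaithfulExceptZero ((freeAdj H h).counit.app P) := by
  rw [freeAdj_counit_app]
  refine ⟨Function.bijective_id, fun s hs => ?_⟩
  have hY : (s.m, s.n) ∈ Y := (H _).2 ⟨s.mem, hs⟩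
  have e : (fun x : ExtHom (restrict h P) (freeExt H (restrict h P) h) s =>
      ofFreeMap H (𝟙 (restrict h P)) x) = fun x => x.val hY :=
    funext fun x => ofFreeMap_of_mem H (𝟙 (restrict h P)) hY x
  change Function.Bijective (fun x : ExtHom (restrict h P) (freeExt H (restrict h P) h) s =>
    ofFreeMap H (𝟙 (restrict h P)) x)
  rw [e]
  exact ext_val_bijective _ hY

theorem terminalAdj_unit_spec (P : StarPolycat.{u} X) :
    BijectiveOnObjects ((terminalAdj H h).unit.app P) ∧
      FullyFaithfulExceptZero ((terminalAdj H h).unit.app P) := by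
  rw [terminalAdj_unit_app]
  refine ⟨Function.bijective_id, fun s hs => ?_⟩
  have hY : (s.m, s.n) ∈ Y := (H _).2 ⟨s.mem, hs⟩
  exact (Function.Bijective.of_comp_iff'
    (ext_val_bijective (terminalExt (restrict h P) h) hY) _).1 Function.bijective_id

end Adjoints

end StarPolycat

/-! ### Permutations and compositions without the order of places -/

namespace StarPoly

section Matching

variable {X Y Z W : Set (ℕ × ℕ)} {O : Type u} [InvolutiveStar O]

/-- An object-preserving permutation between sequents whose arities may be restricted
differently. -/
structure Matching (s : Sequent X O) (t : Sequent Y O) : Type where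
  perm : s.Entry ≃ t.Entry
  label_perm : ∀ x, t.label (perm x) = s.label x

namespace Matching

theorem ext {s : Sequent X O} {t : Sequent Y O} {σ τ : Matching s t}
    (h : ∀ x, σ.perm x = τ.perm x) : σ = τ := by
  cases σ; cases τ
  congr
  exact Equiv.ext h

def trans {s : Sequent X O} {t : Sequent Y O} {w : Sequent Z O} (σ : Matching s t)
    (τ : Matching t w) : Matching s w :=
  ⟨σ.perm.trans τ.perm, fun x => (τ.label_perm _).trans (σ.label_perm x)⟩

def symm {s : Sequent X O} {t : Sequent Y O} (σ : Matching s t) : Matching t s :=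
  ⟨σ.perm.symm, fun x => by rw [← σ.label_perm, Equiv.apply_symm_apply]⟩

def toIso {s t : Sequent X O} (σ : Matching s t) : SeqIso s t := ⟨σ.perm, σ.label_perm⟩

end Matching

def SeqIso.toMatching {s t : Sequent X O} (σ : SeqIso s t) : Matching s t :=
  ⟨σ.perm, σ.label_perm⟩

namespace Sequent

/-- All places of a sequent. -/
def entries {O : Type u} (s : Sequent X O) : List s.Entry := s.domEntries ++ s.codEntries

theorem mem_entries {O : Type u} (s : Sequent X O) (e : s.Entry) : e ∈ s.entries := by
  rcases e with i | j <;> simp [entries, domEntries, codEntries]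

theorem nodup_entries {O : Type u} (s : Sequent X O) : s.entries.Nodup := by
  refine List.Nodup.append ?_ ?_ ?_
  · exact (List.nodup_finRange _).map Sum.inl_injective
  · exact (List.nodup_finRange _).map Sum.inr_injective
  · intro e
    simp only [domEntries, codEntries, List.mem_map]
    rintro ⟨i, _, rfl⟩ ⟨j, _, h⟩
    cases h

theorem injective_of_nodup {O : Type u} (s : Sequent X O) {E : Type} {p : s.Entry → E}
    (h : (s.entries.map p).Nodup) : Function.Injective p := fun x y hxy =>
  List.inj_on_of_nodup_map h (s.mem_entries x) (s.mem_entries y) hxy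

end Sequent

/-- The combinatorial datum of a composition in which no order of the places is recorded. -/
structure Glue (g : Sequent X O) (f : Sequent Y O) (r : Sequent Z O) : Type where
  eg : g.Entry
  ef : f.Entry
  label_cut : f.label ef = star (g.label eg)
  src : r.Entry → g.Entry ⊕ f.Entry
  label_src : ∀ x, r.label x = Sum.elim g.label f.label (src x)
  inj : Function.Injective src
  range : ∀ p, (∃ w, src w = p) ↔ p ≠ .inl eg ∧ p ≠ .inr ef

/-- All three shapes delete the two cut places and rearrange the rest, so multiplicities agree. From
here on the three compositions need not be distinguished. -/
theorem Cut.perm_entries {g f r : Sequent X O} (c : Cut g f r) :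
    List.Perm (.inl c.eg :: .inr c.ef :: r.entries.map c.src)
      (g.entries.map .inl ++ f.entries.map .inr) := by
  let : BEq (g.Entry ⊕ f.Entry) := ⟨fun a b => decide (a = b)⟩
  have : LawfulBEq (g.Entry ⊕ f.Entry) :=
    { eq_of_beq := fun {a b} => of_decide_eq_true, rfl := fun {a} => decide_eq_true rfl }
  rw [List.perm_iff_count]
  intro p
  cases c.shape with
  | m Λ₁ Λ₂ Δ₁ Δ₂ hg hf hd hc =>
    simp only [Sequent.entries, List.map_append, hd, hc, hg, hf, List.count_append,
      List.count_cons, List.map_cons]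
    omega
  | l Λ₁ Λ₂ Γ₁ Γ₂ hg hf hd hc =>
    simp only [Sequent.entries, List.map_append, hd, hc, hg, hf, List.count_append,
      List.count_cons, List.map_cons]
    omega
  | r S₁ S₂ Δ₁ Δ₂ hg hf hd hc =>
    simp only [Sequent.entries, List.map_append, hd, hc, hg, hf, List.count_append,
      List.count_cons, List.map_cons]
    omega

theorem Sequent.nodup_sum_entries {O : Type u} (g : Sequent X O) (f : Sequent Y O) :
    (g.entries.map Sum.inl ++ f.entries.map Sum.inr : List (g.Entry ⊕ f.Entry)).Nodup := by
  refine List.Nodup.append (g.nodup_entries.map Sum.inl_injective)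
    (f.nodup_entries.map Sum.inr_injective) ?_
  intro e
  simp only [List.mem_map]
  rintro ⟨i, _, rfl⟩ ⟨j, _, h⟩
  cases h

/-- The combined list of places of both factors has no repetitions. Hence by `Cut.perm_entries` the
sources of the places of `r` are distinct, avoid the cut places and exhaust all others. -/
def Cut.glue {g f r : Sequent X O} (c : Cut g f r) : Glue g f r where
  eg := c.eg
  ef := c.ef
  label_cut := c.label_cut
  src := c.src
  label_src := c.label_src
  inj := r.injective_of_nodup
    (List.nodup_cons.1 (List.nodup_cons.1
      (c.perm_entries.nodup_iff.2 (g.nodup_sum_entries f))).2).2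
  range p := by
    have hn := c.perm_entries.nodup_iff.2 (g.nodup_sum_entries f)
    have hp : p ∈ (.inl c.eg :: .inr c.ef :: r.entries.map c.src :
        List (g.Entry ⊕ f.Entry)) := by
      rw [c.perm_entries.mem_iff]
      rcases p with x | x
      · simp [g.mem_entries]
      · simp [f.mem_entries]
    rw [List.nodup_cons, List.nodup_cons] at hn
    simp only [List.mem_cons, List.mem_map] at hp hn
    constructor
    · rintro ⟨w, rfl⟩
      exact ⟨fun h => hn.1 (.inr ⟨w, r.mem_entries w, h⟩),
        fun h => hn.2.1 ⟨w, r.mem_entries w, h⟩⟩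
    · rintro ⟨h1, h2⟩
      obtain ⟨w, _, hw⟩ := (hp.resolve_left h1).resolve_left h2
      exact ⟨w, hw⟩

namespace Glue

def swap {g : Sequent X O} {f : Sequent Y O} {r : Sequent Z O} (k : Glue g f r) :
    Glue f g r where
  eg := k.ef
  ef := k.eg
  label_cut := by rw [k.label_cut, star_star]
  src w := (k.src w).swap
  label_src x := by
    rw [k.label_src]
    cases k.src x <;> rfl
  inj x y h := k.inj (Sum.swap_leftInverse.injective h)
  range p := by
    have hs : ∀ (a : g.Entry ⊕ f.Entry) (b : f.Entry ⊕ g.Entry), a.swap = b ↔ a = b.swap := by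
      rintro (a | a) (b | b) <;> simp
    have := k.range p.swap
    simp only [hs]
    rw [this, and_comm]
    rcases p with p | p <;> simp

theorem src_ne_left {g : Sequent X O} {f : Sequent Y O} {r : Sequent Z O} (k : Glue g f r)
    (w : r.Entry) : k.src w ≠ .inl k.eg := ((k.range _).1 ⟨w, rfl⟩).1

theorem src_ne_right {g : Sequent X O} {f : Sequent Y O} {r : Sequent Z O} (k : Glue g f r)
    (w : r.Entry) : k.src w ≠ .inr k.ef := ((k.range _).1 ⟨w, rfl⟩).2

/-- Two data of composition correspond to each other under given permutations. -/
structure Compat {X₁ Y₁ Z₁ : Set (ℕ × ℕ)} {g₁ : Sequent X₁ O} {f₁ : Sequent Y₁ O}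
    {r₁ : Sequent Z₁ O} {g : Sequent X O} {f : Sequent Y O} {r : Sequent Z O}
    (k₁ : Glue g₁ f₁ r₁) (k : Glue g f r) (ρ : Matching g₁ g) (σ : Matching f₁ f)
    (τ : Matching r₁ r) : Prop where
  eg : ρ.perm k₁.eg = k.eg
  ef : σ.perm k₁.ef = k.ef
  src : ∀ z, k.src (τ.perm z) = Sum.map ρ.perm σ.perm (k₁.src z)

theorem Compat.swap {X₁ Y₁ Z₁ : Set (ℕ × ℕ)} {g₁ : Sequent X₁ O} {f₁ : Sequent Y₁ O}
    {r₁ : Sequent Z₁ O} {g : Sequent X O} {f : Sequent Y O} {r : Sequent Z O}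
    {k₁ : Glue g₁ f₁ r₁} {k : Glue g f r} {ρ : Matching g₁ g} {σ : Matching f₁ f}
    {τ : Matching r₁ r} (h : Compat k₁ k ρ σ τ) : Compat k₁.swap k.swap σ ρ τ where
  eg := h.ef
  ef := h.eg
  src z := by
    change (k.src (τ.perm z)).swap = Sum.map _ _ (k₁.src z).swap
    rw [h.src]
    cases k₁.src z <;> rfl

/-- The source map identifies the places of a composite with the uncut places of its factors.
Matchings of the factors that respect the cut places therefore induce a matching of the composites.
-/
theorem exists_compat {X₁ Y₁ Z₁ : Set (ℕ × ℕ)} {g₁ : Sequent X₁ O} {f₁ : Sequent Y₁ O}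
    {r₁ : Sequent Z₁ O} {g : Sequent X O} {f : Sequent Y O} {r : Sequent Z O}
    (k₁ : Glue g₁ f₁ r₁) (k : Glue g f r) (ρ : Matching g₁ g) (σ : Matching f₁ f)
    (hg : ρ.perm k₁.eg = k.eg) (hf : σ.perm k₁.ef = k.ef) :
    ∃ τ : Matching r₁ r, Compat k₁ k ρ σ τ := by
  have hinj : Function.Injective (Sum.map ρ.perm σ.perm) :=
    Sum.map_injective.2 ⟨ρ.perm.injective, σ.perm.injective⟩
  have h1 : ∀ z, ∃ w, k.src w = Sum.map ρ.perm σ.perm (k₁.src z) := fun z => by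
    rw [k.range, ← hg, ← hf]
    exact ⟨fun h => k₁.src_ne_left z (hinj h), fun h => k₁.src_ne_right z (hinj h)⟩
  choose φ hφ using h1
  have hb : Function.Bijective φ := by
    refine ⟨fun x y h => k₁.inj (hinj ?_), fun w => ?_⟩
    · rw [← hφ, ← hφ, h]
    · have hw := (k.range (k.src w)).1 ⟨w, rfl⟩
      obtain ⟨p, hp⟩ : ∃ p, Sum.map ρ.perm σ.perm p = k.src w :=
        (Sum.map_surjective.2 ⟨ρ.perm.surjective, σ.perm.surjective⟩) _
      obtain ⟨z, hz⟩ := (k₁.range p).2 ⟨by rintro rfl; exact hw.1 (by rw [← hp, ← hg]; rfl),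
        by rintro rfl; exact hw.2 (by rw [← hp, ← hf]; rfl)⟩
      exact ⟨z, k.inj (by rw [hφ, hz, hp])⟩
  refine ⟨⟨Equiv.ofBijective φ hb, fun z => ?_⟩, hg, hf, hφ⟩
  rw [k.label_src, k₁.label_src]
  change Sum.elim _ _ (k.src (φ z)) = _
  rw [hφ]
  cases k₁.src z
  · exact ρ.label_perm _
  · exact σ.label_perm _

theorem swap_swap {g : Sequent X O}
    {f : Sequent Y O} {r : Sequent Z O} (k : Glue g f r) : k.swap.swap = k := by
  cases k
  simp [swap]

theorem Compat.trans {X₁ Y₁ Z₁ X₂ Y₂ Z₂ : Set (ℕ × ℕ)}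
    {g₂ : Sequent X₂ O} {f₂ : Sequent Y₂ O} {r₂ : Sequent Z₂ O}
    {g₁ : Sequent X₁ O} {f₁ : Sequent Y₁ O}
    {r₁ : Sequent Z₁ O} {g : Sequent X O} {f : Sequent Y O} {r : Sequent Z O}
    {k₂ : Glue g₂ f₂ r₂} {k₁ : Glue g₁ f₁ r₁} {k : Glue g f r}
    {ρ₂ : Matching g₂ g₁} {σ₂ : Matching f₂ f₁} {τ₂ : Matching r₂ r₁}
    {ρ : Matching g₁ g} {σ : Matching f₁ f} {τ : Matching r₁ r}
    (h₂ : Compat k₂ k₁ ρ₂ σ₂ τ₂) (h : Compat k₁ k ρ σ τ) :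
    Compat k₂ k (ρ₂.trans ρ) (σ₂.trans σ) (τ₂.trans τ) where
  eg := (congrArg ρ.perm h₂.eg).trans h.eg
  ef := (congrArg σ.perm h₂.ef).trans h.ef
  src z := by
    refine (h.src _).trans ?_
    rw [h₂.src, Sum.map_map]
    rfl

end Glue

end Matching

/-! ### Presentations with a chosen output -/

/-- The arities with exactly one output. -/
abbrev CoUnary : Set (ℕ × ℕ) := {p | p.2 = 1}

namespace Sequent

variable {X : Set (ℕ × ℕ)} {O : Type u}

/-- The only output place. -/
def root (t : Sequent CoUnary O) : t.Entry :=
  .inr ⟨0, lt_of_lt_of_eq Nat.zero_lt_one (Eq.symm t.mem)⟩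

theorem codEntries_eq (t : Sequent CoUnary O) : t.codEntries = [t.root] := by
  obtain ⟨m, n, h, d, c⟩ := t
  obtain rfl : n = 1 := h
  rfl

theorem mem_domEntries_of_ne_root (t : Sequent CoUnary O) {e : t.Entry} (he : e ≠ t.root) :
    e ∈ t.domEntries := by
  have h := t.mem_entries e
  rw [entries, List.mem_append, codEntries_eq, List.mem_singleton] at h
  exact h.resolve_right he

variable [InvolutiveStar O]

/-- The sequent with given labelled places as inputs and a given one as output. -/
def rooted {E : Type} (ℓ : E → O) (L : List E) (e : E) : Sequent CoUnary O where
  m := L.length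
  n := 1
  mem := rfl
  dom k := ℓ (L.get k)
  -- Outputs are counted with their duals in the list of places, so this star makes the label equal
  -- to `ℓ e`.
  cod _ := star (ℓ e)

def rootedPlace {E : Type} (ℓ : E → O) (L : List E) (e : E) : (rooted ℓ L e).Entry → E :=
  Sum.elim L.get fun _ => e

theorem label_rooted {E : Type} (ℓ : E → O) (L : List E) (e : E) (x : (rooted ℓ L e).Entry) :
    (rooted ℓ L e).label x = ℓ (rootedPlace ℓ L e x) := by
  rcases x with k | k
  · rfl
  · exact star_star _

theorem map_domEntries_rooted {E : Type} (ℓ : E → O) (L : List E) (e : E) :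
    (rooted ℓ L e).domEntries.map (rootedPlace ℓ L e) = L := by
  rw [domEntries, List.map_map]
  exact List.map_get_finRange L

theorem map_codEntries_rooted {E : Type} (ℓ : E → O) (L : List E) (e : E) :
    (rooted ℓ L e).codEntries.map (rootedPlace ℓ L e) = [e] := by
  rw [codEntries_eq]
  rfl

/-- Put `e` on the right and every other place on the left. This is the cyclic symmetry that makes
one-output morphisms suffice for nonempty sequents. -/
theorem exists_matching_root (s : Sequent X O) (e : s.Entry) :
    ∃ (t : Sequent CoUnary O) (σ : Matching t s), σ.perm t.root = e := by
  obtain ⟨L₁, L₂, hL⟩ := List.append_of_mem (s.mem_entries e)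
  have hp : List.Perm ((rooted s.label (L₁ ++ L₂) e).entries.map
      (rootedPlace s.label (L₁ ++ L₂) e)) s.entries := by
    rw [show ∀ t : Sequent CoUnary O, t.entries = t.domEntries ++ t.codEntries from fun _ => rfl,
      List.map_append, map_domEntries_rooted, map_codEntries_rooted, hL]
    exact (List.perm_append_singleton _ _).trans List.perm_middle.symm
  have hb : Function.Bijective (rootedPlace s.label (L₁ ++ L₂) e) := by
    refine ⟨injective_of_nodup _ (hp.nodup_iff.2 s.nodup_entries), fun x => ?_⟩
    obtain ⟨w, _, hw⟩ := List.mem_map.1 (hp.mem_iff.2 (s.mem_entries x))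
    exact ⟨w, hw⟩
  exact ⟨_, ⟨Equiv.ofBijective _ hb, fun x => (label_rooted _ _ _ x).symm⟩, rfl⟩

end Sequent

/-- This is substitution in a multicategory: the output of `f` is plugged into an input of `g`, and
the output of `g` survives. It is the shape `m` with nothing on either side of the cut output. -/
theorem exists_cut {O : Type u} [InvolutiveStar O] (g f : Sequent CoUnary O) (e : g.Entry)
    (he : e ≠ g.root) (hl : f.label f.root = star (g.label e)) :
    ∃ (r : Sequent CoUnary O) (c : Cut g f r),
      c.eg = e ∧ c.ef = f.root ∧ c.src r.root = .inl g.root := by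
  obtain ⟨Λ₁, Λ₂, hg⟩ := List.append_of_mem (g.mem_domEntries_of_ne_root he)
  refine ⟨Sequent.rooted (Sum.elim g.label f.label)
    (Λ₁.map Sum.inl ++ f.domEntries.map Sum.inr ++ Λ₂.map Sum.inl) (.inl g.root),
    ⟨e, f.root, hl, Sequent.rootedPlace _ _ _, Sequent.label_rooted _ _ _,
      .m Λ₁ Λ₂ [] [] hg (by rw [Sequent.codEntries_eq]; rfl)
        (Sequent.map_domEntries_rooted _ _ _) ?_⟩, rfl, rfl, rfl⟩
  rw [Sequent.map_codEntries_rooted, Sequent.codEntries_eq]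
  rfl

namespace Glue

variable {X Y Z : Set (ℕ × ℕ)}

theorem exists_cut {O : Type u} [InvolutiveStar O]
    {g : Sequent X O} {f : Sequent Y O} {r : Sequent Z O} (k : Glue g f r)
    {g₁ f₁ : Sequent CoUnary O} (ρ : Matching g₁ g) (σ : Matching f₁ f)
    (hg : ρ.perm g₁.root ≠ k.eg) (hf : σ.perm f₁.root = k.ef) :
    ∃ (r₁ : Sequent CoUnary O) (c : Cut g₁ f₁ r₁) (τ : Matching r₁ r),
      Compat c.glue k ρ σ τ ∧ c.ef = f₁.root ∧
        k.src (τ.perm r₁.root) = .inl (ρ.perm g₁.root) := by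
  have he : ρ.perm.symm k.eg ≠ g₁.root := fun h => hg <| by
    rw [← h, Equiv.apply_symm_apply]
  obtain ⟨r₁, c, h1, h2, h3⟩ := StarPoly.exists_cut g₁ f₁ _ he (by
    rw [← σ.label_perm, hf, k.label_cut, ← ρ.label_perm, Equiv.apply_symm_apply])
  obtain ⟨τ, hτ⟩ := Glue.exists_compat c.glue k ρ σ
    ((congrArg ρ.perm h1).trans (Equiv.apply_symm_apply _ _)) ((congrArg σ.perm h2).trans hf)
  exact ⟨r₁, c, τ, hτ, h2, (hτ.src _).trans (congrArg _ h3)⟩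

theorem exists_compat_of_src_inl {O : Type u} [InvolutiveStar O] {g : Sequent X O}
    {f : Sequent Y O} {r : Sequent Z O} (k : Glue g f r) {w : r.Entry} {e : g.Entry}
    (hw : k.src w = .inl e) :
    ∃ (g₁ f₁ r₁ : Sequent CoUnary O) (c : Cut g₁ f₁ r₁) (ρ : Matching g₁ g)
      (σ : Matching f₁ f) (τ : Matching r₁ r), Compat c.glue k ρ σ τ := by
  obtain ⟨g₁, ρ, hρ⟩ := g.exists_matching_root e
  obtain ⟨f₁, σ, hσ⟩ := f.exists_matching_root k.ef
  obtain ⟨r₁, c, τ, hτ, -⟩ := exists_cut k ρ σ (by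
    rw [hρ]
    exact fun h => k.src_ne_left w (hw.trans (congrArg _ h))) hσ
  exact ⟨g₁, f₁, r₁, c, ρ, σ, τ, hτ⟩

/-- The surviving place `w` becomes the output of the composite. The factor it comes from must be
the outer one, hence the two alternatives. The argument needs a surviving place, and this is where
`(0,0)` has to be excluded. -/
theorem exists_compat_or {O : Type u} [InvolutiveStar O] {g : Sequent X O}
    {f : Sequent Y O} {r : Sequent Z O} (k : Glue g f r) (w : r.Entry) :
    (∃ (g₁ f₁ r₁ : Sequent CoUnary O) (c : Cut g₁ f₁ r₁) (ρ : Matching g₁ g)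
      (σ : Matching f₁ f) (τ : Matching r₁ r), Compat c.glue k ρ σ τ) ∨
    (∃ (f₁ g₁ r₁ : Sequent CoUnary O) (c : Cut f₁ g₁ r₁) (σ : Matching f₁ f)
      (ρ : Matching g₁ g) (τ : Matching r₁ r), Compat c.glue k.swap σ ρ τ) := by
  rcases hw : k.src w with e | e
  · exact .inl (exists_compat_of_src_inl k hw)
  · exact .inr (exists_compat_of_src_inl k.swap (w := w) (e := e) (congrArg Sum.swap hw))

end Glue

end StarPoly

/-! ### Families over all one-output presentations, and their composition -/

namespace StarPolycat

open StarPoly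

variable {X Y Z W V U : Set (ℕ × ℕ)} {Q : StarPolycat.{u} CoUnary}

/-- A morphism of type `s` in the completion of `Q`: a compatible family of morphisms of `Q`,
one for each way of listing the places of `s` with exactly one of them as output. -/
structure Family (Q : StarPolycat.{u} CoUnary) (s : Sequent X Q.Obj) : Type u where
  val : ∀ {t : Sequent CoUnary Q.Obj}, Matching t s → Q.Hom t
  compat : ∀ {t t' : Sequent CoUnary Q.Obj} (σ : Matching t s) (σ' : Matching t' s)
    (ρ : SeqIso t t'), (∀ x, σ'.perm (ρ.perm x) = σ.perm x) → Q.act ρ (val σ) = val σ'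

namespace Family

theorem act_val {s : Sequent X Q.Obj} (x : Family Q s) {t t' : Sequent CoUnary Q.Obj}
    (σ : Matching t s) (σ' : Matching t' s) :
    Q.act (σ.trans σ'.symm).toIso (x.val σ) = x.val σ' :=
  x.compat _ _ _ fun _ => Equiv.apply_symm_apply _ _

theorem ext {s : Sequent X Q.Obj} {x y : Family Q s}
    (h : ∀ {t : Sequent CoUnary Q.Obj} (σ : Matching t s), x.val σ = y.val σ) : x = y := by
  have hv : @x.val = @y.val := by
    funext t σ
    exact h σ
  cases x; cases y
  cases hv
  rfl

/-- Any two members of a family differ by a permutation, so one member determines all. Equations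
between families are checked on whichever presentation is convenient. -/
theorem ext_of_val {s : Sequent X Q.Obj} {x y : Family Q s} {t : Sequent CoUnary Q.Obj}
    (σ : Matching t s) (h : x.val σ = y.val σ) : x = y :=
  ext fun σ' => by rw [← x.act_val σ σ', ← y.act_val σ σ', h]

/-- The family determined by one of its members. -/
def ofMember {s : Sequent X Q.Obj} {t : Sequent CoUnary Q.Obj} (σ : Matching t s)
    (x : Q.Hom t) : Family Q s where
  val σ' := Q.act (σ.trans σ'.symm).toIso x
  compat σ' σ'' ρ h := by
    rw [← Q.act_trans]
    congr 1
    exact SeqIso.ext fun z => (Equiv.eq_symm_apply _).2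
      ((h _).trans (Equiv.apply_symm_apply _ _))

theorem ofMember_val {s : Sequent X Q.Obj} {t : Sequent CoUnary Q.Obj} (σ : Matching t s)
    (x : Q.Hom t) : (ofMember σ x).val σ = x := by
  refine Eq.trans ?_ (Q.act_refl x)
  change Q.act _ x = _
  congr 1
  exact SeqIso.ext fun z => Equiv.symm_apply_apply _ _

/-- The action of permutations on families. -/
def act {s : Sequent X Q.Obj} {s' : Sequent Y Q.Obj} (ρ : Matching s s') (x : Family Q s) :
    Family Q s' where
  val σ := x.val (σ.trans ρ.symm)
  compat σ σ' τ h := x.compat _ _ _ fun z => congrArg ρ.perm.symm (h z)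

theorem act_val_trans {s : Sequent X Q.Obj} {s' : Sequent Y Q.Obj} (ρ : Matching s s')
    (x : Family Q s) {t : Sequent CoUnary Q.Obj} (σ : Matching t s) :
    (x.act ρ).val (σ.trans ρ) = x.val σ := by
  change x.val _ = _
  congr 1
  exact Matching.ext fun z => Equiv.symm_apply_apply _ _

/-- `z` has the members that a composite of `y` and `x` should have. -/
def IsComp {g : Sequent X Q.Obj} {f : Sequent Y Q.Obj} {r : Sequent Z Q.Obj} (k : Glue g f r)
    (y : Family Q g) (x : Family Q f) (z : Family Q r) : Prop :=
  ∀ {g₁ f₁ r₁ : Sequent CoUnary Q.Obj} (c : Cut g₁ f₁ r₁) (ρ : Matching g₁ g)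
    (σ : Matching f₁ f) (τ : Matching r₁ r), Glue.Compat c.glue k ρ σ τ →
    Q.comp c (y.val ρ) (x.val σ) = z.val τ

theorem symm_perm_eq {s s₁ s₂ : Type} (ρ : s₁ ≃ s) (ρ' : s₂ ≃ s) {a : s₁} {b : s₂}
    {e : s} (h : ρ a = e) (h' : ρ' b = e) : (ρ.trans ρ'.symm) a = b := by
  rw [Equiv.trans_apply, h, ← h', Equiv.symm_apply_apply]

/-- Well-definedness of composition. Another presentation with the same outer factor is handled by
equivariance in `Q`, one with the factors exchanged by the symmetry axiom for `A` and `A•`. -/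
theorem isComp_of_compat {g : Sequent X Q.Obj} {f : Sequent Y Q.Obj} {r : Sequent Z Q.Obj}
    (k : Glue g f r) (y : Family Q g) (x : Family Q f)
    {g₁ f₁ r₁ : Sequent CoUnary Q.Obj} (c : Cut g₁ f₁ r₁) (ρ : Matching g₁ g)
    (σ : Matching f₁ f) (τ : Matching r₁ r) (h : Glue.Compat c.glue k ρ σ τ) :
    IsComp k y x (ofMember τ (Q.comp c (y.val ρ) (x.val σ))) ∧
      IsComp k.swap x y (ofMember τ (Q.comp c (y.val ρ) (x.val σ))) := by
  constructor
  · intro g₂ f₂ r₂ c' ρ' σ' τ' h'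
    rw [← y.act_val ρ ρ', ← x.act_val σ σ']
    refine Q.comp_act c c' _ _ _ _ _ (symm_perm_eq _ _ h.eg h'.eg)
      (symm_perm_eq _ _ h.ef h'.ef) fun z => ?_
    -- Both presentations trace a place back to the same place of `g` or `f`; inverting the second
    -- pair of matchings compares the two source maps.
    have h1 := h.src z
    have h2 := h'.src (τ'.perm.symm (τ.perm z))
    rw [Equiv.apply_symm_apply, h1] at h2
    have h3 := congrArg (Sum.map ρ'.perm.symm σ'.perm.symm) h2
    simp only [Sum.map_map, Equiv.symm_comp_self, Sum.map_id_id, id] at h3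
    exact h3.symm
  · intro f₂ g₂ r₂ c' σ' ρ' τ' h'
    rw [← y.act_val ρ ρ', ← x.act_val σ σ']
    refine Q.comp_swap c c' _ _ _ _ _ (symm_perm_eq _ _ h.eg h'.ef)
      (symm_perm_eq _ _ h.ef h'.eg) fun z => ?_
    have h1 := h.swap.src z
    have h2 := h'.src (τ'.perm.symm (τ.perm z))
    rw [Equiv.apply_symm_apply, h1] at h2
    have h3 := congrArg (Sum.map σ'.perm.symm ρ'.perm.symm) h2
    simp only [Sum.map_map, Equiv.symm_comp_self, Sum.map_id_id, id] at h3
    refine h3.symm.trans ?_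
    change Sum.map _ _ (c.src z).swap = _
    cases c.src z <;> rfl

theorem exists_isComp {g : Sequent X Q.Obj} {f : Sequent Y Q.Obj} {r : Sequent Z Q.Obj}
    (hr : Nonempty r.Entry) (k : Glue g f r) (y : Family Q g) (x : Family Q f) :
    ∃ z, IsComp k y x z ∧ IsComp k.swap x y z := by
  obtain ⟨w⟩ := hr
  rcases Glue.exists_compat_or k w with ⟨g₁, f₁, r₁, c, ρ, σ, τ, h⟩ | ⟨f₁, g₁, r₁, c, σ, ρ, τ, h⟩
  · exact ⟨_, isComp_of_compat k y x c ρ σ τ h⟩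
  · have h' := isComp_of_compat k.swap x y c σ ρ τ h
    rw [Glue.swap_swap] at h'
    exact ⟨_, h'.symm⟩

/-- Composition of families. -/
noncomputable def comp {g : Sequent X Q.Obj} {f : Sequent Y Q.Obj} {r : Sequent Z Q.Obj}
    (hr : Nonempty r.Entry) (k : Glue g f r) (y : Family Q g) (x : Family Q f) : Family Q r :=
  (exists_isComp hr k y x).choose

section

variable {g : Sequent X Q.Obj} {f : Sequent Y Q.Obj} {r : Sequent Z Q.Obj}

theorem comp_isComp (hr : Nonempty r.Entry) (k : Glue g f r) (y : Family Q g)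
    (x : Family Q f) : IsComp k y x (comp hr k y x) :=
  (exists_isComp hr k y x).choose_spec.1

theorem comp_isComp_swap (hr : Nonempty r.Entry) (k : Glue g f r) (y : Family Q g)
    (x : Family Q f) : IsComp k.swap x y (comp hr k y x) :=
  (exists_isComp hr k y x).choose_spec.2

/-- Both orders are needed as hypotheses, since the available presentation may have either factor as
the outer one. -/
theorem IsComp.eq_comp (hr : Nonempty r.Entry) {k : Glue g f r} {y : Family Q g}
    {x : Family Q f} {z : Family Q r} (h : IsComp k y x z) (h' : IsComp k.swap x y z) :
    z = comp hr k y x := by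
  obtain ⟨w⟩ := id hr
  rcases Glue.exists_compat_or k w with ⟨g₁, f₁, r₁, c, ρ, σ, τ, hc⟩ | ⟨f₁, g₁, r₁, c, σ, ρ, τ, hc⟩
  · exact ext_of_val τ ((h c ρ σ τ hc).symm.trans (comp_isComp hr k y x c ρ σ τ hc))
  · exact ext_of_val τ ((h' c σ ρ τ hc).symm.trans (comp_isComp_swap hr k y x c σ ρ τ hc))

theorem comp_swap (hr : Nonempty r.Entry) (k : Glue g f r) (y : Family Q g)
    (x : Family Q f) : comp hr k.swap x y = comp hr k y x := by
  have h : IsComp k.swap.swap y x (comp hr k.swap x y) := comp_isComp_swap hr k.swap x y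
  rw [Glue.swap_swap] at h
  exact IsComp.eq_comp hr h (comp_isComp hr k.swap x y)

end

theorem comp_act {X₁ Y₁ Z₁ : Set (ℕ × ℕ)} {g₁ : Sequent X₁ Q.Obj} {f₁ : Sequent Y₁ Q.Obj}
    {r₁ : Sequent Z₁ Q.Obj} {g : Sequent X Q.Obj} {f : Sequent Y Q.Obj} {r : Sequent Z Q.Obj}
    (hr₁ : Nonempty r₁.Entry) (hr : Nonempty r.Entry) {k₁ : Glue g₁ f₁ r₁} {k : Glue g f r}
    {ρ : Matching g₁ g} {σ : Matching f₁ f} {τ : Matching r₁ r} (h : Glue.Compat k₁ k ρ σ τ)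
    (y : Family Q g₁) (x : Family Q f₁) :
    comp hr k (y.act ρ) (x.act σ) = (comp hr₁ k₁ y x).act τ := by
  obtain ⟨w⟩ := id hr₁
  rcases Glue.exists_compat_or k₁ w with
    ⟨g₂, f₂, r₂, c, ρ', σ', τ', hc⟩ | ⟨f₂, g₂, r₂, c, σ', ρ', τ', hc⟩
  · refine ext_of_val (τ'.trans τ) ?_
    rw [act_val_trans, ← comp_isComp hr₁ k₁ y x c ρ' σ' τ' hc,
      ← comp_isComp hr k _ _ c _ _ _ (hc.trans h), act_val_trans, act_val_trans]
  · refine ext_of_val (τ'.trans τ) ?_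
    rw [act_val_trans, ← comp_isComp_swap hr₁ k₁ y x c σ' ρ' τ' hc,
      ← comp_isComp_swap hr k _ _ c _ _ _ (hc.trans h.swap), act_val_trans,
      act_val_trans]

end Family

end StarPolycat

/-! ### Associativity for families -/

namespace StarPolycat

open StarPoly

namespace Family

variable {X : Set (ℕ × ℕ)} {Q : StarPolycat.{u} CoUnary}

theorem act_val_eq {s s' : Sequent X Q.Obj} (ρ : Matching s s') (x : Family Q s)
    {t t' : Sequent CoUnary Q.Obj} (σ : Matching t s) (σ' : Matching t' s') :
    (x.act ρ).val σ' = Q.act ((σ.trans ρ).trans σ'.symm).toIso (x.val σ) := by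
  rw [← act_val_trans ρ x σ, act_val]

theorem act_symm_act {s s' : Sequent X Q.Obj} (ρ : Matching s s') (x : Family Q s') :
    (x.act ρ.symm).act ρ = x := by
  refine ext fun σ => ?_
  change x.val _ = x.val σ
  congr 1
  exact Matching.ext fun z => Equiv.apply_symm_apply _ _

variable {h g f u v r r' : Sequent X Q.Obj}

/-- With the output in `h`, and `g` and `f` rooted at their cut places towards `h`, all four
compositions are multicategorical substitutions, and the claim is nested associativity in `Q`. -/
theorem assoc_of_root_outer (hu : Nonempty u.Entry) (hv : Nonempty v.Entry)
    (hr : Nonempty r.Entry) (hr' : Nonempty r'.Entry)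
    (k₁ : Glue h g u) (k₂ : Glue u f r) (k₃ : Glue g f v)
    (k₄ : Glue h v r') (τ : Matching r r') (z : Family Q h) (y : Family Q g) (x : Family Q f)
    (h₁ : k₄.eg = k₁.eg) (h₂ : k₃.src k₄.ef = .inl k₁.ef) (h₃ : k₁.src k₂.eg = .inr k₃.eg)
    (h₄ : k₂.ef = k₃.ef)
    (h₅ : ∀ w, Sum.map id k₃.src (k₄.src (τ.perm w)) =
      Equiv.sumAssoc _ _ _ (Sum.map k₁.src id (k₂.src w)))
    (w : u.Entry) (e : h.Entry) (hw' : k₁.src w = .inl e) :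
    comp hr' k₄ z (comp hv k₃ y x) = (comp hr k₂ (comp hu k₁ z y) x).act τ := by
  obtain ⟨h', ρh, hh⟩ := h.exists_matching_root e
  obtain ⟨g', ρg, hg⟩ := g.exists_matching_root k₁.ef
  obtain ⟨f', ρf, hf⟩ := f.exists_matching_root k₂.ef
  have he : e ≠ k₁.eg := by
    rintro rfl
    exact k₁.src_ne_left w hw'
  obtain ⟨u', c₁, τu, n₁, d₁, s₁⟩ := Glue.exists_cut k₁ ρh ρg (by rwa [hh]) hg
  obtain ⟨r₁, c₂, τr, n₂, d₂, s₂⟩ := Glue.exists_cut k₂ τu ρf (by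
    intro hc
    rw [hc, h₃] at s₁
    cases s₁) hf
  obtain ⟨v', c₃, τv, n₃, d₃, s₃⟩ := Glue.exists_cut k₃ ρg ρf (by
    rw [hg]
    intro hc
    exact k₁.src_ne_right k₂.eg (by rw [h₃, hc])) (hf.trans h₄)
  -- The output of the presentation of `v` is its cut place with `h`: both come from the place
  -- `k₁.ef` of `g`.
  obtain ⟨r₂, c₄, τr', n₄, d₄, s₄⟩ := Glue.exists_cut k₄ ρh τv (by rwa [hh, h₁])
    (k₃.inj (by rw [s₃, hg, h₂]))
  refine ext_of_val τr' ?_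
  rw [act_val_eq τ _ τr τr', ← comp_isComp hr' k₄ _ _ c₄ ρh τv τr' n₄,
    ← comp_isComp hv k₃ _ _ c₃ ρg ρf τv n₃, ← comp_isComp hr k₂ _ _ c₂ τu ρf τr n₂,
    ← comp_isComp hu k₁ _ _ c₁ ρh ρg τu n₁]
  -- The side conditions are those on the gluings, pulled back along injective matchings.
  refine Q.assoc c₁ c₂ c₃ c₄ _ _ _ _ ?_ ?_ ?_ ?_ fun w => ?_
  · exact ρh.perm.injective (n₄.eg.trans (h₁.trans n₁.eg.symm))
  · have := (n₃.src c₄.ef).symm.trans ((congrArg k₃.src n₄.ef).trans h₂)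
    rw [← n₁.ef] at this
    exact Sum.map_injective.2 ⟨ρg.perm.injective, ρf.perm.injective⟩ this
  · have := (n₁.src c₂.eg).symm.trans ((congrArg k₁.src n₂.eg).trans h₃)
    rw [← n₃.eg] at this
    exact Sum.map_injective.2 ⟨ρh.perm.injective, ρg.perm.injective⟩ this
  · exact ρf.perm.injective (n₂.ef.trans (h₄.trans n₃.ef.symm))
  · have hw := h₅ (τr.perm w)
    rw [n₂.src, ← τr'.perm.apply_symm_apply (τ.perm (τr.perm w)), n₄.src] at hw
    refine Sum.map_injective.2 ⟨ρh.perm.injective,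
      Sum.map_injective.2 ⟨ρg.perm.injective, ρf.perm.injective⟩⟩ (Eq.trans ?_ (hw.trans ?_))
    · change Sum.map _ _ (Sum.map id c₃.src (c₄.src (τr'.perm.symm (τ.perm (τr.perm w))))) =
        Sum.map id k₃.src (Sum.map _ _ (c₄.src (τr'.perm.symm (τ.perm (τr.perm w)))))
      rcases c₄.src (τr'.perm.symm (τ.perm (τr.perm w))) with a | a
      · rfl
      · exact congrArg Sum.inr (n₃.src a).symm
    · change Equiv.sumAssoc _ _ _ (Sum.map k₁.src id (Sum.map _ _ (c₂.src w))) = _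
      rcases c₂.src w with a | a
      · refine (congrArg (fun p => Equiv.sumAssoc _ _ _ (Sum.inl p)) (n₁.src a)).trans ?_
        change _ = Sum.map _ _ (Equiv.sumAssoc _ _ _ (Sum.inl (c₁.src a)))
        change Equiv.sumAssoc _ _ _ (Sum.inl (Sum.map _ _ (c₁.src a))) = _
        rcases c₁.src a with b | b <;> rfl
      · rfl

/-- With the output in `h`, both `g` and `f` are plugged into inputs of `h`, and the claim is the
interchange of parallel substitutions in `Q`. -/
theorem assoc_right_of_root_middle (hu : Nonempty u.Entry) (hv : Nonempty v.Entry)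
    (hr : Nonempty r.Entry) (hr' : Nonempty r'.Entry)
    (k₁ : Glue h g u) (k₂ : Glue u f r) (k₃ : Glue h f v)
    (k₄ : Glue v g r') (τ : Matching r r') (z : Family Q h) (y : Family Q g) (x : Family Q f)
    (h₁ : k₃.src k₄.eg = .inl k₁.eg) (h₂ : k₄.ef = k₁.ef) (h₃ : k₁.src k₂.eg = .inl k₃.eg)
    (h₄ : k₂.ef = k₃.ef)
    (h₅ : ∀ w, Sum.map k₃.src id (k₄.src (τ.perm w)) =
      swapRight (Sum.map k₁.src id (k₂.src w)))
    (w : r.Entry) (w' : u.Entry) (e : h.Entry) (hw : k₂.src w = .inl w')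
    (hw' : k₁.src w' = .inl e) :
    comp hr' k₄ (comp hv k₃ z x) y = (comp hr k₂ (comp hu k₁ z y) x).act τ := by
  obtain ⟨h', ρh, hh⟩ := h.exists_matching_root e
  obtain ⟨g', ρg, hg⟩ := g.exists_matching_root k₁.ef
  obtain ⟨f', ρf, hf⟩ := f.exists_matching_root k₂.ef
  have he : e ≠ k₁.eg := by
    rintro rfl
    exact k₁.src_ne_left w' hw'
  -- The place `w'` survives the second cut, so `e` is not where `f` enters.
  have he' : e ≠ k₃.eg := by
    rintro rfl
    exact k₂.src_ne_left w (hw.trans (congrArg _ (k₁.inj (hw'.trans h₃.symm))))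
  obtain ⟨u', c₁, τu, n₁, d₁, s₁⟩ := Glue.exists_cut k₁ ρh ρg (by rwa [hh]) hg
  obtain ⟨r₁, c₂, τr, n₂, d₂, s₂⟩ := Glue.exists_cut k₂ τu ρf (by
    intro hc
    rw [hc, h₃, hh] at s₁
    exact he' (Sum.inl_injective s₁).symm) hf
  obtain ⟨v', c₃, τv, n₃, d₃, s₃⟩ := Glue.exists_cut k₃ ρh ρf (by rwa [hh])
    (hf.trans h₄)
  obtain ⟨r₂, c₄, τr', n₄, d₄, s₄⟩ := Glue.exists_cut k₄ τv ρg (by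
    intro hc
    rw [hc, h₁, hh] at s₃
    exact he (Sum.inl_injective s₃).symm) (hg.trans h₂.symm)
  refine ext_of_val τr' ?_
  rw [act_val_eq τ _ τr τr', ← comp_isComp hr' k₄ _ _ c₄ τv ρg τr' n₄,
    ← comp_isComp hv k₃ _ _ c₃ ρh ρf τv n₃, ← comp_isComp hr k₂ _ _ c₂ τu ρf τr n₂,
    ← comp_isComp hu k₁ _ _ c₁ ρh ρg τu n₁]
  refine Q.assoc_right c₁ c₂ c₃ c₄ _ _ _ _ ?_ ?_ ?_ ?_ fun w => ?_
  · have := (n₃.src c₄.eg).symm.trans ((congrArg k₃.src n₄.eg).trans h₁)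
    rw [← n₁.eg] at this
    exact Sum.map_injective.2 ⟨ρh.perm.injective, ρf.perm.injective⟩ this
  · exact ρg.perm.injective (n₄.ef.trans (h₂.trans n₁.ef.symm))
  · have := (n₁.src c₂.eg).symm.trans ((congrArg k₁.src n₂.eg).trans h₃)
    rw [← n₃.eg] at this
    exact Sum.map_injective.2 ⟨ρh.perm.injective, ρg.perm.injective⟩ this
  · exact ρf.perm.injective (n₂.ef.trans (h₄.trans n₃.ef.symm))
  · have hw := h₅ (τr.perm w)
    rw [n₂.src, ← τr'.perm.apply_symm_apply (τ.perm (τr.perm w)), n₄.src] at hw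
    refine Sum.map_injective.2 ⟨Sum.map_injective.2 ⟨ρh.perm.injective, ρf.perm.injective⟩,
      ρg.perm.injective⟩ (Eq.trans ?_ (hw.trans ?_))
    · change Sum.map _ _ (Sum.map c₃.src id (c₄.src (τr'.perm.symm (τ.perm (τr.perm w))))) =
        Sum.map k₃.src id (Sum.map _ _ (c₄.src (τr'.perm.symm (τ.perm (τr.perm w)))))
      rcases c₄.src (τr'.perm.symm (τ.perm (τr.perm w))) with a | a
      · exact congrArg Sum.inl (n₃.src a).symm
      · rfl
    · change swapRight (Sum.map k₁.src id (Sum.map _ _ (c₂.src w))) = _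
      rcases c₂.src w with a | a
      · refine (congrArg (fun p => swapRight (Sum.inl p)) (n₁.src a)).trans ?_
        change swapRight (Sum.inl (Sum.map _ _ (c₁.src a))) =
          Sum.map _ _ (swapRight (Sum.inl (c₁.src a)))
        rcases c₁.src a with b | b <;> rfl
      · rfl

/-- The chain `h – g – f` has no preferred direction once factors may be exchanged. A surviving
place lies in one of the three and decides which law of `Q` applies: nested if it is at an end,
parallel if it is in the middle. -/
theorem assoc (hu : Nonempty u.Entry) (hv : Nonempty v.Entry)
    (hr : Nonempty r.Entry) (hr' : Nonempty r'.Entry)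
    (k₁ : Glue h g u) (k₂ : Glue u f r) (k₃ : Glue g f v)
    (k₄ : Glue h v r') (τ : Matching r r') (z : Family Q h) (y : Family Q g) (x : Family Q f)
    (h₁ : k₄.eg = k₁.eg) (h₂ : k₃.src k₄.ef = .inl k₁.ef) (h₃ : k₁.src k₂.eg = .inr k₃.eg)
    (h₄ : k₂.ef = k₃.ef)
    (h₅ : ∀ w, Sum.map id k₃.src (k₄.src (τ.perm w)) =
      Equiv.sumAssoc _ _ _ (Sum.map k₁.src id (k₂.src w))) :
    comp hr' k₄ z (comp hv k₃ y x) = (comp hr k₂ (comp hu k₁ z y) x).act τ := by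
  obtain ⟨w⟩ := id hr
  rcases hw : k₂.src w with w' | e
  · rcases hw' : k₁.src w' with e | e
    · exact assoc_of_root_outer hu hv hr hr' k₁ k₂ k₃ k₄ τ z y x h₁ h₂ h₃ h₄ h₅ w' e hw'
    -- The output lies in `g`, which becomes the base with `h` and `f` plugged into it.
    · rw [← comp_swap hr' k₄, ← comp_swap hu k₁]
      refine assoc_right_of_root_middle hu hv hr hr' k₁.swap k₂ k₃ k₄.swap τ y z x h₂ h₁
        (congrArg Sum.swap h₃) h₄ (fun w => ?_) w w' e hw (congrArg Sum.swap hw')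
      have h6 := h₅ w
      refine Eq.trans (b := (Sum.map id k₃.src (k₄.src (τ.perm w))).swap) ?_
        ((congrArg Sum.swap h6).trans ?_)
      · change Sum.map k₃.src id (k₄.src (τ.perm w)).swap = _
        rcases k₄.src (τ.perm w) with b | b <;> rfl
      · rcases k₂.src w with a | a
        · change (Equiv.sumAssoc _ _ _ (Sum.inl (k₁.src a))).swap =
            swapRight (Sum.inl (k₁.src a).swap)
          rcases k₁.src a with b | b <;> rfl
        · rfl
  -- The output lies in `f`: read the chain backwards, with `f` outermost and `τ` inverted.
  · obtain ⟨v₀, hv₀⟩ := (k₃.range (.inr e)).2 ⟨by simp, fun h' => k₂.src_ne_right w (by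
      rw [hw, h₄, Sum.inr_injective h'])⟩
    have key := assoc_of_root_outer hv hu hr' hr k₃.swap k₄.swap k₁.swap k₂.swap τ.symm x y z
      h₄ (congrArg Sum.swap h₃) (congrArg Sum.swap h₂) h₁ (fun w => ?_) v₀ e
      (congrArg Sum.swap hv₀)
    · rw [comp_swap, comp_swap, comp_swap, comp_swap] at key
      rw [key, act_symm_act]
    · have h6 := h₅ (τ.perm.symm w)
      rw [Equiv.apply_symm_apply] at h6
      have h7 : Sum.map (fun w => (k₁.src w)) id (k₂.src (τ.perm.symm w)) =
        (Equiv.sumAssoc _ _ _).symm (Sum.map id k₃.src (k₄.src w)) :=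
        ((Equiv.symm_apply_eq _).2 h6).symm
      change Sum.map id (fun w => (k₁.src w).swap) (k₂.src (τ.perm.symm w)).swap =
        Equiv.sumAssoc _ _ _ (Sum.map (fun w => (k₃.src w).swap) id (k₄.src w).swap)
      trans Sum.map id Sum.swap (Sum.map k₁.src id (k₂.src (τ.perm.symm w))).swap
      · rcases k₂.src (τ.perm.symm w) with b | b <;> rfl
      · rw [h7]
        rcases k₄.src w with b | b
        · rfl
        · change Sum.map id Sum.swap
            (Sum.swap ((Equiv.sumAssoc _ _ _).symm (Sum.inr (k₃.src b)))) =
              Equiv.sumAssoc _ _ _ (Sum.inl (k₃.src b).swap)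
          rcases k₃.src b with b | b <;> rfl

/-- Two morphisms plugged into `h` form a chain with `h` in the middle, so exchanging factors
reduces this to `assoc`. The same device gives `assoc_left`. -/
theorem assoc_right (hu : Nonempty u.Entry) (hv : Nonempty v.Entry)
    (hr : Nonempty r.Entry) (hr' : Nonempty r'.Entry)
    (k₁ : Glue h g u) (k₂ : Glue u f r) (k₃ : Glue h f v)
    (k₄ : Glue v g r') (τ : Matching r r') (z : Family Q h) (y : Family Q g) (x : Family Q f)
    (h₁ : k₃.src k₄.eg = .inl k₁.eg) (h₂ : k₄.ef = k₁.ef) (h₃ : k₁.src k₂.eg = .inl k₃.eg)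
    (h₄ : k₂.ef = k₃.ef)
    (h₅ : ∀ w, Sum.map k₃.src id (k₄.src (τ.perm w)) =
      swapRight (Sum.map k₁.src id (k₂.src w))) :
    comp hr' k₄ (comp hv k₃ z x) y = (comp hr k₂ (comp hu k₁ z y) x).act τ := by
  rw [← comp_swap hr' k₄, ← comp_swap hu k₁]
  refine assoc hu hv hr hr' k₁.swap k₂ k₃ k₄.swap τ y z x h₂ h₁ (congrArg Sum.swap h₃) h₄
    fun w => ?_
  change Sum.map id k₃.src (k₄.src (τ.perm w)).swap = _
  trans (Sum.map k₃.src id (k₄.src (τ.perm w))).swap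
  · rcases k₄.src (τ.perm w) with b | b <;> rfl
  · rw [h₅]
    rcases k₂.src w with b | b
    · change (swapRight (Sum.inl (k₁.src b))).swap =
        Equiv.sumAssoc _ _ _ (Sum.inl (k₁.src b).swap)
      rcases k₁.src b with b | b <;> rfl
    · rfl

theorem assoc_left (hu : Nonempty u.Entry) (hv : Nonempty v.Entry)
    (hr : Nonempty r.Entry) (hr' : Nonempty r'.Entry)
    (k₁ : Glue g f u) (k₂ : Glue h u r) (k₃ : Glue h f v)
    (k₄ : Glue g v r') (τ : Matching r r') (z : Family Q h) (y : Family Q g) (x : Family Q f)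
    (h₁ : k₄.eg = k₁.eg) (h₂ : k₃.src k₄.ef = .inr k₁.ef) (h₃ : k₂.eg = k₃.eg)
    (h₄ : k₁.src k₂.ef = .inr k₃.ef)
    (h₅ : ∀ w, Sum.map id k₃.src (k₄.src (τ.perm w)) =
      swapLeft (Sum.map id k₁.src (k₂.src w))) :
    comp hr' k₄ y (comp hv k₃ z x) = (comp hr k₂ z (comp hu k₁ y x)).act τ := by
  rw [← comp_swap hr k₂, ← comp_swap hv k₃]
  refine assoc hu hv hr hr' k₁ k₂.swap k₃.swap k₄ τ y x z h₁ (congrArg Sum.swap h₂) h₄ h₃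
    fun w => ?_
  trans Sum.map id Sum.swap (Sum.map id k₃.src (k₄.src (τ.perm w)))
  · rcases k₄.src (τ.perm w) with b | b <;> rfl
  · rw [h₅]
    change _ = Equiv.sumAssoc _ _ _ (Sum.map k₁.src id (k₂.src w).swap)
    rcases k₂.src w with b | b
    · rfl
    · change Sum.map id Sum.swap (swapLeft (Sum.inr (k₁.src b))) =
        Equiv.sumAssoc _ _ _ (Sum.inl (k₁.src b))
      rcases k₁.src b with b | b <;> rfl

end Family

end StarPolycat

/-! ### Identities of families, and the completed polycategory -/

namespace StarPoly

variable {X Y : Set (ℕ × ℕ)} {O : Type u} [InvolutiveStar O]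

/-- A sequent with exactly two places, occupied by `A` and `A•`, in any arrangement. -/
structure LooseIdent (A : O) (s : Sequent X O) : Type where
  pos : s.Entry
  neg : s.Entry
  label_pos : s.label pos = A
  label_neg : s.label neg = star A
  ne : neg ≠ pos
  total : ∀ x, x = pos ∨ x = neg

def Ident.loose {A : O} {s : Sequent X O} (i : Ident A s) : LooseIdent A s where
  pos := i.pos
  neg := i.neg
  label_pos := i.label_pos
  label_neg := i.label_neg
  ne := by
    have h := s.nodup_entries
    unfold Sequent.entries at h
    rcases i.shape with ⟨h1, h2⟩ | ⟨h1, h2⟩ | ⟨h1, h2⟩ <;>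
      simp only [h1, h2, List.cons_append, List.nil_append, List.append_nil, List.nodup_cons,
        List.mem_singleton] at h
    · exact fun h' => h.1 h'.symm
    · exact h.1
    · exact h.1
  total x := by
    have h := s.mem_entries x
    unfold Sequent.entries at h
    rcases i.shape with ⟨h1, h2⟩ | ⟨h1, h2⟩ | ⟨h1, h2⟩ <;>
      simp only [h1, h2, List.cons_append, List.nil_append, List.append_nil, List.mem_cons,
        List.not_mem_nil, or_false] at h
    · exact h
    · exact h.symm
    · exact h.symm

namespace LooseIdent

def swap {A : O} {s : Sequent X O} (i : LooseIdent A s) : LooseIdent (star A) s :=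
  ⟨i.neg, i.pos, i.label_neg, by rw [i.label_pos, star_star], i.ne.symm,
    fun x => (i.total x).symm⟩

def matching {A : O} {s : Sequent X O} {t : Sequent Y O} (i : LooseIdent A s)
    (j : LooseIdent A t) : Matching s t where
  perm :=
    { toFun := fun x => if x = i.pos then j.pos else j.neg
      invFun := fun x => if x = j.pos then i.pos else i.neg
      left_inv := fun x => by
        rcases i.total x with rfl | rfl
        · simp
        · simp [i.ne, j.ne]
      right_inv := fun x => by
        rcases j.total x with rfl | rfl
        · simp
        · simp [i.ne, j.ne] }
  label_perm x := by
    rcases i.total x with rfl | rfl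
    · simp [i.label_pos, j.label_pos]
    · simp [i.ne, i.label_neg, j.label_neg]

theorem matching_pos {A : O} {s : Sequent X O} {t : Sequent Y O} (i : LooseIdent A s)
    (j : LooseIdent A t) : (i.matching j).perm i.pos = j.pos :=
  if_pos rfl

theorem matching_neg {A : O} {s : Sequent X O} {t : Sequent Y O} (i : LooseIdent A s)
    (j : LooseIdent A t) : (i.matching j).perm i.neg = j.neg :=
  if_neg i.ne

/-- Gluing along one end of an identity replaces the cut place of `f` by the other end, which
carries the same label. -/
theorem exists_matching {A : O} {s : Sequent X O} {f r : Sequent Y O} (i : LooseIdent A s)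
    (k : Glue s f r) (hk : k.eg = i.pos) :
    ∃ τ : Matching r f, ∀ z, τ.perm z = Sum.elim (fun _ => k.ef) id (k.src z) := by
  have hl : ∀ z a, k.src z = .inl a → a = i.neg := fun z a hz => (i.total a).resolve_left
    fun h => k.src_ne_left z (by rw [hz, h, hk])
  have hb : Function.Bijective fun z => Sum.elim (fun _ => k.ef) id (k.src z) := by
    refine ⟨fun z z' h => k.inj ?_, fun x => ?_⟩
    · rcases hz : k.src z with a | a <;> rcases hz' : k.src z' with b | b <;>
        simp only [hz, hz', Sum.elim_inl, Sum.elim_inr, id] at h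
      · rw [hl z a hz, hl z' b hz']
      · exact absurd hz' (h ▸ k.src_ne_right z')
      · exact absurd hz (h ▸ k.src_ne_right z)
      · rw [h]
    · by_cases hx : x = k.ef
      · obtain ⟨z, hz⟩ := (k.range (.inl i.neg)).2
          ⟨fun h => i.ne ((Sum.inl_injective h).trans hk), by simp⟩
        exact ⟨z, by simp only [hz, Sum.elim_inl, hx]⟩
      · obtain ⟨z, hz⟩ := (k.range (.inr x)).2 ⟨by simp, fun h => hx (Sum.inr_injective h)⟩
        exact ⟨z, by simp only [hz, Sum.elim_inr, id]⟩
  refine ⟨⟨Equiv.ofBijective _ hb, fun z => ?_⟩, fun _ => rfl⟩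
  rw [Equiv.ofBijective_apply, k.label_src]
  rcases hz : k.src z with a | a
  · simp only [Sum.elim_inl]
    rw [k.label_cut, hl z a hz, hk, i.label_pos, i.label_neg]
  · rfl

end LooseIdent

/-- The sequent `(A; A)`. -/
def idSequent (A : O) : Sequent CoUnary O := ⟨1, 1, rfl, fun _ => A, fun _ => A⟩

def idIdent (A : O) : Ident A (idSequent A) :=
  ⟨.inl (0 : Fin 1), .inr (0 : Fin 1), rfl, rfl, .inl ⟨rfl, rfl⟩⟩

end StarPoly

namespace StarPolycat

open StarPoly

variable {X : Set (ℕ × ℕ)} {Q : StarPolycat.{u} CoUnary}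

namespace Family

/-- The family of identities. -/
def one {A : Q.Obj} {s : Sequent X Q.Obj} (i : LooseIdent A s) : Family Q s :=
  ofMember ((idIdent A).loose.matching i) (Q.one (idIdent A))

theorem one_val {A : Q.Obj} {s : Sequent X Q.Obj} (i : LooseIdent A s)
    {t : Sequent CoUnary Q.Obj} (j : Ident A t) (σ : Matching t s)
    (hp : σ.perm j.pos = i.pos) (hn : σ.perm j.neg = i.neg) : (one i).val σ = Q.one j := by
  refine Q.act_one (idIdent A) j _ ?_ ?_
  · exact (Equiv.symm_apply_eq _).2 ((LooseIdent.matching_pos _ _).trans hp.symm)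
  · exact (Equiv.symm_apply_eq _).2 ((LooseIdent.matching_neg _ _).trans hn.symm)

theorem act_one {Y : Set (ℕ × ℕ)} {A : Q.Obj} {s : Sequent X Q.Obj} {t : Sequent Y Q.Obj}
    (i : LooseIdent A s) (j : LooseIdent A t) (σ : Matching s t) (hp : σ.perm i.pos = j.pos)
    (hn : σ.perm i.neg = j.neg) : (one i).act σ = one j := by
  refine ext_of_val (((idIdent A).loose.matching i).trans σ) ?_
  rw [act_val_trans, one_val i (idIdent A) _ (LooseIdent.matching_pos _ _)
    (LooseIdent.matching_neg _ _), one_val j (idIdent A)]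
  · exact (congrArg σ.perm (LooseIdent.matching_pos (idIdent A).loose i)).trans hp
  · exact (congrArg σ.perm (LooseIdent.matching_neg (idIdent A).loose i)).trans hn

theorem one_comp {A : Q.Obj} {s f r : Sequent X Q.Obj} (hr : Nonempty r.Entry)
    (i : LooseIdent A s) (k : Glue s f r) (τ : Matching r f) (x : Family Q f)
    (hk : k.eg = i.pos)
    (hτ : ∀ z, τ.perm z = Sum.elim (fun _ => k.ef) id (k.src z)) :
    (comp hr k (one i) x).act τ = x := by
  obtain ⟨f₁, σ, hσ⟩ := f.exists_matching_root k.ef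
  -- The output of `(A; A)` is its negative place while the cut is at the positive one, so the
  -- identity can be the outer factor.
  obtain ⟨r₁, c, τr, n, -, -⟩ := Glue.exists_cut k ((idIdent A).loose.matching i) σ (by
    rw [hk]
    exact fun h => i.ne ((LooseIdent.matching_neg (idIdent A).loose i).symm.trans h)) hσ
  refine ext_of_val σ ?_
  rw [act_val_eq τ _ τr σ, ← comp_isComp hr k _ _ c _ σ τr n,
    one_val i (idIdent A) _ (LooseIdent.matching_pos _ _) (LooseIdent.matching_neg _ _)]
  refine Q.one_comp (idIdent A) c _ _ ?_ fun z => ?_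
  · refine ((idIdent A).loose.matching i).perm.injective (n.eg.trans (hk.trans ?_))
    exact (LooseIdent.matching_pos (idIdent A).loose i).symm
  · refine (Equiv.symm_apply_eq _).2 ((hτ _).trans ?_)
    rw [n.src]
    change Sum.elim _ _ (Sum.map _ _ (c.src z)) = _
    rcases c.src z with a | a
    · exact n.ef.symm
    · rfl

/-- The identities of `A` and of `A•` coincide as families. This is the uniqueness of units: their
composite equals each of them, by the left unit law applied before and after exchanging the factors.
-/
theorem one_swap_idIdent (A : Q.Obj) :
    one (idIdent A).loose.swap = (one (idIdent A).loose : Family Q (idSequent A)) := by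
  obtain ⟨r, c, h1, h2, h3⟩ := exists_cut (idSequent A) (idSequent A) (idIdent A).pos
    (fun h => nomatch h) rfl
  have hk : c.glue.eg = (idIdent A).loose.pos := h1
  have hk' : c.glue.swap.eg = (idIdent A).loose.swap.pos := h2
  obtain ⟨τ, hτ⟩ := (idIdent A).loose.exists_matching c.glue hk
  have hr : Nonempty r.Entry := ⟨r.root⟩
  have e := one_comp hr (idIdent A).loose c.glue τ (one (idIdent A).loose.swap) hk hτ
  rw [← comp_swap] at e
  refine e.symm.trans (one_comp hr (idIdent A).loose.swap c.glue.swap τ _ hk' fun z => ?_)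
  rw [hτ]
  change _ = Sum.elim (fun _ => c.glue.eg) id (c.glue.src z).swap
  rcases hz : c.glue.src z with a | a
  · exact h2.trans (((idIdent A).loose.total a).resolve_left fun h =>
      c.glue.src_ne_left z (by rw [hz, h, hk])).symm
  · exact (((idIdent A).loose.total a).resolve_right fun h =>
      c.glue.src_ne_right z (by rw [hz, h]; exact congrArg _ h2.symm)).trans hk.symm

theorem one_swap {A : Q.Obj} {s : Sequent X Q.Obj} (i : LooseIdent A s) :
    one i.swap = one i := by
  have hp := LooseIdent.matching_pos (idIdent A).loose i
  have hn := LooseIdent.matching_neg (idIdent A).loose i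
  rw [← act_one (idIdent A).loose i _ hp hn, ← one_swap_idIdent]
  exact (act_one (idIdent A).loose.swap i.swap _ hn hp).symm

/-- Exchanging the factors turns the right unit law for `A` into the left one for `A•`; `one_swap`
identifies the two identities. -/
theorem comp_one {A : Q.Obj} {g s r : Sequent X Q.Obj} (hr : Nonempty r.Entry)
    (i : LooseIdent A s) (k : Glue g s r) (τ : Matching r g) (y : Family Q g)
    (hk : k.ef = i.neg)
    (hτ : ∀ z, τ.perm z = Sum.elim id (fun _ => k.eg) (k.src z)) :
    (comp hr k y (one i)).act τ = y := by
  rw [← comp_swap, ← one_swap]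
  refine one_comp hr i.swap k.swap τ y hk fun z => (hτ z).trans ?_
  change _ = Sum.elim _ _ (k.src z).swap
  rcases k.src z <;> rfl

end Family

theorem nonempty_entry {O : Type u} (hX : ∀ p ∈ X, p ≠ (0, 0)) (s : Sequent X O) :
    Nonempty s.Entry := by
  by_cases hm : s.m = 0
  · exact ⟨.inr ⟨0, Nat.pos_of_ne_zero fun hn => hX _ s.mem (by rw [hm, hn])⟩⟩
  · exact ⟨.inl ⟨0, Nat.pos_of_ne_zero hm⟩⟩

/-- The polycategory of families of a polycategory with exactly one output. -/
noncomputable def complete (hX : ∀ p ∈ X, p ≠ (0, 0)) (Q : StarPolycat.{u} CoUnary) :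
    StarPolycat.{u} X where
  Obj := Q.Obj
  Hom := Family Q
  act σ x := x.act σ.toMatching
  act_refl _ := rfl
  act_trans _ _ _ := rfl
  one i := Family.one i.loose
  act_one i j σ h₁ h₂ := Family.act_one i.loose j.loose σ.toMatching h₁ h₂
  comp {_ _ r} c y x := Family.comp (nonempty_entry hX r) c.glue y x
  comp_act c c₁ ρ σ τ y x h₁ h₂ h₃ := Family.comp_act _ _
    (⟨h₁, h₂, h₃⟩ : Glue.Compat c.glue c₁.glue ρ.toMatching σ.toMatching τ.toMatching) y x
  comp_swap c c₁ ρ σ τ y x h₁ h₂ h₃ := by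
    rw [← Family.comp_swap _ c.glue]
    refine Family.comp_act _ _ (⟨h₂, h₁, fun z => (h₃ z).trans ?_⟩ :
      Glue.Compat c.glue.swap c₁.glue σ.toMatching ρ.toMatching τ.toMatching) x y
    change _ = Sum.map _ _ (c.src z).swap
    rcases c.src z <;> rfl
  one_comp i c τ x h₁ h₂ := Family.one_comp _ i.loose c.glue τ.toMatching x h₁ h₂
  comp_one i c τ y h₁ h₂ := Family.comp_one _ i.loose c.glue τ.toMatching y h₁ h₂
  assoc c₁ c₂ c₃ c₄ τ z y x h₁ h₂ h₃ h₄ h₅ := Family.assoc _ _ _ _ c₁.glue c₂.glue c₃.glue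
    c₄.glue τ.toMatching z y x h₁ h₂ h₃ h₄ h₅
  assoc_right c₁ c₂ c₃ c₄ τ z y x h₁ h₂ h₃ h₄ h₅ := Family.assoc_right _ _ _ _ c₁.glue c₂.glue
    c₃.glue c₄.glue τ.toMatching z y x h₁ h₂ h₃ h₄ h₅
  assoc_left c₁ c₂ c₃ c₄ τ z y x h₁ h₂ h₃ h₄ h₅ := Family.assoc_left _ _ _ _ c₁.glue c₂.glue
    c₃.glue c₄.glue τ.toMatching z y x h₁ h₂ h₃ h₄ h₅

end StarPolycat

/-! ### The equivalence with one-output polycategories -/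

namespace StarPoly

variable {X : Set (ℕ × ℕ)} {O : Type u} [InvolutiveStar O]

/-- A matching from a sequent with one output, as an isomorphism of sequents. -/
def Matching.toInclIso (h : CoUnary ⊆ X) {t : Sequent CoUnary O} {s : Sequent X O}
    (σ : Matching t s) : SeqIso (t.incl h) s := ⟨σ.perm, σ.label_perm⟩

def inclMatching (h : CoUnary ⊆ X) (t : Sequent CoUnary O) : Matching t (t.incl h) :=
  ⟨Equiv.refl _, fun _ => rfl⟩

theorem exists_inclIso (h : CoUnary ⊆ X) (hX : ∀ p ∈ X, p ≠ (0, 0)) (s : Sequent X O) :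
    ∃ t : Sequent CoUnary O, Nonempty (SeqIso (t.incl h) s) := by
  obtain ⟨e⟩ := StarPolycat.nonempty_entry hX s
  obtain ⟨t, σ, -⟩ := s.exists_matching_root e
  exact ⟨t, ⟨σ.toInclIso h⟩⟩

end StarPoly

namespace StarPolycat

open StarPoly

variable {X : Set (ℕ × ℕ)} (h : CoUnary ⊆ X) (hX : ∀ p ∈ X, p ≠ (0, 0))

theorem complete_val_bijective {Q : StarPolycat.{u} CoUnary} (s : Sequent CoUnary Q.Obj) :
    Function.Bijective fun x : Family Q (s.incl h) => x.val (inclMatching h s) :=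
  ⟨fun _ _ hxy => Family.ext_of_val _ hxy, fun x => ⟨_, Family.ofMember_val _ x⟩⟩

theorem one_val_inclMatching {Q : StarPolycat.{u} CoUnary} {A : Q.Obj}
    {s : Sequent CoUnary Q.Obj} (i : Ident A s) :
    ((complete hX Q).one (i.incl h)).val (inclMatching h s) = Q.one i :=
  Family.one_val (i.incl h).loose i _ rfl rfl

theorem act_val_inclMatching {Q : StarPolycat.{u} CoUnary} {s t : Sequent CoUnary Q.Obj}
    (σ : SeqIso s t) (x : Family Q (s.incl h)) :
    ((complete hX Q).act (σ.incl h) x).val (inclMatching h t) =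
      Q.act σ (x.val (inclMatching h s)) :=
  (x.compat _ _ σ fun z => σ.perm.symm_apply_apply z).symm

theorem comp_val_inclMatching {Q : StarPolycat.{u} CoUnary} {g f r : Sequent CoUnary Q.Obj}
    (c : Cut g f r) (y : Family Q (g.incl h)) (x : Family Q (f.incl h)) :
    ((complete hX Q).comp (c.incl h) y x).val (inclMatching h r) =
      Q.comp c (y.val (inclMatching h g)) (x.val (inclMatching h f)) :=
  (Family.comp_isComp (nonempty_entry hX (r.incl h)) (c.incl h).glue y x c (inclMatching h g)
    (inclMatching h f) (inclMatching h r) ⟨rfl, rfl, fun z => by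
      change c.src z = Sum.map id id (c.src z)
      rw [Sum.map_id_id]; rfl⟩).symm

/-- Evaluation of families at the given list of places. -/
noncomputable def completeProj (Q : StarPolycat.{u} CoUnary) : Functor (restrict h (complete hX Q)) Q where
  obj := id
  obj_star _ := rfl
  map {s} x := Family.val (Q := Q) x (inclMatching h s)
  map_act σ x := act_val_inclMatching (Q := Q) h hX σ x
  map_one i := one_val_inclMatching (Q := Q) h hX i
  map_comp c y x := comp_val_inclMatching (Q := Q) h hX c y x

/-- The inverse of evaluation. -/
noncomputable def completeIncl (Q : StarPolycat.{u} CoUnary) : Functor Q (restrict h (complete hX Q)) where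
  obj := id
  obj_star _ := rfl
  map {s} x := Family.ofMember (inclMatching h s) x
  map_act {s t} σ x := (complete_val_bijective h t).1 <|
    (Family.ofMember_val _ _).trans <| Eq.symm <|
      (act_val_inclMatching h hX σ (Family.ofMember (inclMatching h s) x)).trans
        (congrArg (Q.act σ) (Family.ofMember_val _ x))
  map_one {A s} i := (complete_val_bijective h s).1 <|
    (Family.ofMember_val _ _).trans (one_val_inclMatching h hX i).symm
  map_comp {g f r} c y x := (complete_val_bijective h r).1 <|
    (Family.ofMember_val _ _).trans <| Eq.symm <|
      (comp_val_inclMatching h hX c (Family.ofMember (inclMatching h g) y)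
        (Family.ofMember (inclMatching h f) x)).trans
        (congrArg₂ (Q.comp c) (Family.ofMember_val _ y) (Family.ofMember_val _ x))

noncomputable def completeIso (Q : StarPolycat.{u} CoUnary) : (forget h).obj (complete hX Q) ≅ Q where
  hom := completeProj h hX Q
  inv := completeIncl h hX Q
  hom_inv_id := by
    refine Functor.ext_map rfl fun s x => heq_of_eq ?_
    exact (complete_val_bijective (Q := Q) h s).1 (Family.ofMember_val _ _)
  inv_hom_id := by
    refine Functor.ext_map rfl fun s x => heq_of_eq ?_
    exact Family.ofMember_val (Q := Q) (inclMatching h s) x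

theorem essSurj_forget_coUnary (hX : ∀ p ∈ X, p ≠ (0, 0)) : (forget.{u} h).EssSurj where
  mem_essImage Q := ⟨complete hX Q, ⟨completeIso h hX Q⟩⟩

theorem act_act_symm (P : StarPolycat.{u} X) {s t : Sequent X P.Obj} (σ : SeqIso s t)
    (x : P.Hom t) : P.act σ (P.act σ.symm x) = x := by
  rw [← P.act_trans]
  refine Eq.trans ?_ (P.act_refl x)
  exact congrArg (fun τ => P.act τ x) (SeqIso.ext fun z => σ.perm.apply_symm_apply z)

/-- Every morphism is a permuted one-output morphism, and functors commute with permutations. -/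
theorem faithful_forget_coUnary (hX : ∀ p ∈ X, p ≠ (0, 0)) : (forget.{u} h).Faithful where
  map_injective {P P' F G} hFG := by
    obtain ⟨o, h1, m, h2, h3, h4⟩ := F
    obtain ⟨o', h1', m', h2', h3', h4'⟩ := G
    obtain rfl : o = o' := congrArg Functor.obj hFG
    refine Functor.ext_map rfl fun s x => heq_of_eq ?_
    obtain ⟨t, ⟨σ⟩⟩ := exists_inclIso h hX s
    change m x = m' x
    rw [← act_act_symm P σ x, h2, h2']
    exact congrArg (P'.act _) (eq_of_heq (Functor.map_heq hFG (s := t) (P.act σ.symm x)))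

section Full

variable {h} {P P' : StarPolycat.{u} X} (F : Functor (restrict h P) (restrict h P'))

/-- The representative with one output of a sequent. -/
noncomputable def rep {O : Type u} [InvolutiveStar O] (h : CoUnary ⊆ X)
    (hX : ∀ p ∈ X, p ≠ (0, 0)) (s : Sequent X O) : Sequent CoUnary O :=
  (exists_inclIso h hX s).choose

noncomputable def repIso {O : Type u} [InvolutiveStar O] (h : CoUnary ⊆ X)
    (hX : ∀ p ∈ X, p ≠ (0, 0)) (s : Sequent X O) : SeqIso ((rep h hX s).incl h) s :=
  (exists_inclIso h hX s).choose_spec.some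

/-- The extension of a functor along representatives. -/
noncomputable def liftMap {s : Sequent X P.Obj} (x : P.Hom s) : P'.Hom (s.map F.obj) :=
  P'.act ((repIso h hX s).map F.obj F.obj_star)
    (F.map (s := rep h hX s) (P.act (repIso h hX s).symm x))

/-- The chosen representative does not matter. Functoriality of the extension is checked with this
formula, using whichever one-output presentation suits the operation. -/
theorem liftMap_act {s : Sequent X P.Obj} {t : Sequent CoUnary P.Obj}
    (σ : SeqIso (t.incl h) s) (y : P.Hom (t.incl h)) :
    liftMap hX F (P.act σ y) = P'.act (σ.map F.obj F.obj_star) (F.map (s := t) y) := by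
  -- The two presentations of `s` differ by a permutation between one-output sequents, and `F`
  -- respects it.
  let ρ : SeqIso t (rep h hX s) :=
    ⟨(σ.trans (repIso h hX s).symm).perm, (σ.trans (repIso h hX s).symm).label_perm⟩
  have e : P.act (repIso h hX s).symm (P.act σ y) = (restrict h P).act ρ y :=
    (P.act_trans _ _ _).symm
  refine (congrArg (fun z => P'.act ((repIso h hX s).map F.obj F.obj_star)
    (F.map (s := rep h hX s) z)) e).trans ?_
  refine (congrArg (P'.act ((repIso h hX s).map F.obj F.obj_star)) (F.map_act ρ y)).trans ?_
  refine (P'.act_trans _ _ _).symm.trans ?_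
  exact congrArg (fun τ => P'.act τ (F.map (s := t) y))
    (SeqIso.ext fun z => Equiv.apply_symm_apply _ _)

theorem exists_act (P : StarPolycat.{u} X) {s : Sequent X P.Obj} {t : Sequent CoUnary P.Obj}
    (σ : SeqIso (t.incl h) s) (x : P.Hom s) : ∃ y, x = P.act σ y :=
  ⟨P.act σ.symm x, (act_act_symm P σ x).symm⟩

/-- Functors between underlying polycategories with one output extend. -/
noncomputable def lift : Functor P P' where
  obj := F.obj
  obj_star := F.obj_star
  map := liftMap hX F
  map_act {s s'} τ x := by
    obtain ⟨t, ⟨σ⟩⟩ := exists_inclIso h hX s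
    obtain ⟨y, rfl⟩ := exists_act P σ x
    rw [← P.act_trans]
    refine (liftMap_act hX F _ y).trans ?_
    refine Eq.trans ?_ (congrArg (P'.act _) (liftMap_act hX F σ y).symm)
    exact P'.act_trans (σ.map F.obj F.obj_star) (τ.map F.obj F.obj_star) _
  map_one {A s} i := by
    have hp := LooseIdent.matching_pos (idIdent A).loose i.loose
    have hn := LooseIdent.matching_neg (idIdent A).loose i.loose
    rw [← P.act_one ((idIdent A).incl h) i
      (((idIdent A).loose.matching i.loose).toInclIso h) hp hn]
    refine (liftMap_act hX F _ _).trans ?_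
    refine (congrArg (P'.act _) (F.map_one (idIdent A))).trans ?_
    exact P'.act_one (((idIdent A).incl h).map F.obj F.obj_star) (i.map F.obj F.obj_star)
      ((((idIdent A).loose.matching i.loose).toInclIso h).map F.obj F.obj_star) hp hn
  map_comp {g f r} c y x := by
    obtain ⟨w⟩ := nonempty_entry hX r
    rcases Glue.exists_compat_or c.glue w with
      ⟨g₁, f₁, r₁, c₁, ρ, σ, τ, n⟩ | ⟨f₁, g₁, r₁, c₁, σ, ρ, τ, n⟩
    · obtain ⟨y, rfl⟩ := exists_act P (ρ.toInclIso h) y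
      obtain ⟨x, rfl⟩ := exists_act P (σ.toInclIso h) x
      rw [P.comp_act (c₁.incl h) c (ρ.toInclIso h) (σ.toInclIso h) (τ.toInclIso h) y x
        n.eg n.ef n.src]
      refine (liftMap_act hX F _ _).trans ?_
      refine (congrArg (P'.act _) (F.map_comp c₁ y x)).trans ?_
      refine Eq.trans ?_ (congrArg₂ (P'.comp (c.map F.obj F.obj_star))
        (liftMap_act hX F _ y).symm (liftMap_act hX F _ x).symm)
      exact (P'.comp_act ((c₁.incl h).map F.obj F.obj_star) (c.map F.obj F.obj_star)
        ((ρ.toInclIso h).map F.obj F.obj_star) ((σ.toInclIso h).map F.obj F.obj_star)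
        ((τ.toInclIso h).map F.obj F.obj_star) _ _ n.eg n.ef n.src).symm
    -- Here the output comes from `f`, so the one-output composite has the factors exchanged and the
    -- symmetry axiom replaces equivariance.
    · have hs : ∀ z, c.src (τ.perm z) = (Sum.map σ.perm ρ.perm (c₁.src z)).swap := fun z =>
        (Sum.swap_swap _).symm.trans (congrArg Sum.swap (n.src z))
      obtain ⟨y, rfl⟩ := exists_act P (ρ.toInclIso h) y
      obtain ⟨x, rfl⟩ := exists_act P (σ.toInclIso h) x
      rw [P.comp_swap (c₁.incl h) c (σ.toInclIso h) (ρ.toInclIso h) (τ.toInclIso h) x y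
        n.eg n.ef hs]
      refine (liftMap_act hX F _ _).trans ?_
      refine (congrArg (P'.act _) (F.map_comp c₁ x y)).trans ?_
      refine Eq.trans ?_ (congrArg₂ (P'.comp (c.map F.obj F.obj_star))
        (liftMap_act hX F _ y).symm (liftMap_act hX F _ x).symm)
      exact (P'.comp_swap ((c₁.incl h).map F.obj F.obj_star) (c.map F.obj F.obj_star)
        ((σ.toInclIso h).map F.obj F.obj_star) ((ρ.toInclIso h).map F.obj F.obj_star)
        ((τ.toInclIso h).map F.obj F.obj_star) _ _ n.eg n.ef hs).symm

end Full

theorem full_forget_coUnary (hX : ∀ p ∈ X, p ≠ (0, 0)) : (forget.{u} h).Full where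
  map_surjective {P P'} F := ⟨lift hX F, Functor.ext_map rfl fun s x => heq_of_eq <| by
    refine (congrArg (fun y => liftMap hX F y) (P.act_refl x).symm).trans ?_
    refine (liftMap_act hX F (SeqIso.refl (s.incl h)) x).trans ?_
    exact P'.act_refl _⟩

theorem isEquivalence_forget_coUnary (hX : ∀ p ∈ X, p ≠ (0, 0)) : (forget.{u} h).IsEquivalence where
  faithful := faithful_forget_coUnary h hX
  full := full_forget_coUnary h hX
  essSurj := essSurj_forget_coUnary h hX

end StarPolycat

/-! ### Transport along the equivalence, and the three cases -/

namespace StarPolycat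

open StarPoly

variable {X X' Y : Set (ℕ × ℕ)}

/-- The properties of a left adjoint to the forgetful functor. -/
def HasGoodLeftAdjoint (h : Y ⊆ X) : Prop :=
  ∃ (L : StarPolycat.{u} Y ⥤ StarPolycat.{u} X) (adj : L ⊣ forget.{u} h),
    L.Full ∧ L.Faithful ∧ IsIso adj.unit ∧
    ∀ P : StarPolycat.{u} X, BijectiveOnObjects (adj.counit.app P) ∧
      FullyFaithfulExceptZero (adj.counit.app P)

def HasGoodRightAdjoint (h : Y ⊆ X) : Prop :=
  ∃ (R : StarPolycat.{u} Y ⥤ StarPolycat.{u} X) (adj : forget.{u} h ⊣ R),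
    R.Full ∧ R.Faithful ∧ IsIso adj.counit ∧
    ∀ P : StarPolycat.{u} X, BijectiveOnObjects (adj.unit.app P) ∧
      FullyFaithfulExceptZero (adj.unit.app P)

theorem hasGoodLeftAdjoint_of_removesZero (H : RemovesZero X Y) (h : Y ⊆ X) :
    HasGoodLeftAdjoint.{u} h := by
  have := isIso_freeAdj_unit.{u} H (h := h)
  exact ⟨freeFunctor H h, freeAdj H h, (freeAdj H h).fullyFaithfulLOfIsIsoUnit.full,
    (freeAdj H h).fullyFaithfulLOfIsIsoUnit.faithful, this, freeAdj_counit_spec H⟩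

theorem hasGoodRightAdjoint_of_removesZero (H : RemovesZero X Y) (h : Y ⊆ X) :
    HasGoodRightAdjoint.{u} h := by
  have := isIso_terminalAdj_counit.{u} H (h := h)
  exact ⟨terminalFunctor H h, terminalAdj H h,
    (terminalAdj H h).fullyFaithfulROfIsIsoCounit.full,
    (terminalAdj H h).fullyFaithfulROfIsIsoCounit.faithful, this, terminalAdj_unit_spec H⟩

/-- The counit of the composite adjunction is an isomorphism followed by the old counit, and
isomorphisms are bijective on objects and on all morphism sets. -/
theorem HasGoodLeftAdjoint.comp_isEquivalence {h : Y ⊆ X'} {h' : X' ⊆ X} {h'' : Y ⊆ X}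
    (hL : HasGoodLeftAdjoint.{u} h') [(forget.{u} h).IsEquivalence] :
    HasGoodLeftAdjoint.{u} h'' := by
  obtain ⟨L, adj, hf, hfa, -, hc⟩ := hL
  let e := (forget.{u} h).asEquivalence
  -- Forgetting in two stages is definitionally forgetting at once.
  let adj' : e.inverse ⋙ L ⊣ forget.{u} h'' := e.symm.toAdjunction.comp adj
  have hfull : (e.inverse ⋙ L).Full := inferInstance
  have hfaithful : (e.inverse ⋙ L).Faithful := inferInstance
  refine ⟨e.inverse ⋙ L, adj', hfull, hfaithful, inferInstance, fun P => ?_⟩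
  have key : adj'.counit.app P =
      L.map (e.symm.toAdjunction.counit.app ((forget h').obj P)) ≫ adj.counit.app P :=
    Adjunction.comp_counit_app _ _ _
  have hi : IsIso (e.symm.toAdjunction.counit.app ((forget h').obj P)) :=
    (e.symm.counitIso.app _).isIso_hom
  have hi' := CategoryTheory.Functor.map_isIso L
    (e.symm.toAdjunction.counit.app ((forget h').obj P))
  rw [key]
  exact ⟨(@bijectiveOnObjects_of_isIso _ _ _ _ hi').comp (hc P).1,
    (@fullyFaithfulExceptZero_of_isIso _ _ _ _ hi').comp (hc P).2⟩

theorem HasGoodRightAdjoint.comp_isEquivalence {h : Y ⊆ X'} {h' : X' ⊆ X} {h'' : Y ⊆ X}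
    (hR : HasGoodRightAdjoint.{u} h') [(forget.{u} h).IsEquivalence] :
    HasGoodRightAdjoint.{u} h'' := by
  obtain ⟨R, adj, hf, hfa, -, hc⟩ := hR
  let e := (forget.{u} h).asEquivalence
  let adj' : forget.{u} h'' ⊣ e.inverse ⋙ R := adj.comp e.toAdjunction
  have hfull : (e.inverse ⋙ R).Full := inferInstance
  have hfaithful : (e.inverse ⋙ R).Faithful := inferInstance
  refine ⟨e.inverse ⋙ R, adj', hfull, hfaithful, inferInstance, fun P => ?_⟩
  have key : adj'.unit.app P =
      adj.unit.app P ≫ R.map (e.toAdjunction.unit.app ((forget h').obj P)) :=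
    Adjunction.comp_unit_app _ _ _
  have hi : IsIso (e.toAdjunction.unit.app ((forget h').obj P)) :=
    (e.unitIso.app _).isIso_hom
  have hi' := CategoryTheory.Functor.map_isIso R
    (e.toAdjunction.unit.app ((forget h').obj P))
  rw [key]
  exact ⟨(hc P).1.comp (@bijectiveOnObjects_of_isIso _ _ _ _ hi'),
    (hc P).2.comp (@fullyFaithfulExceptZero_of_isIso _ _ _ _ hi')⟩

end StarPolycat

theorem mainTheorem7 {X Y : Set (ℕ × ℕ)} (h : Y ⊆ X)
    (hXY :
      (X = {p | p.2 = 0} ∧ Y = {p | 0 < p.1 ∧ p.2 = 0}) ∨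
      (X = Set.univ ∧ Y = {p | 0 < p.1 + p.2}) ∨
      (X = {p | p.2 = 0 ∨ p.2 = 1} ∧ Y = {p | p.2 = 1})) :
    (∃ (L : StarPolycat.{u} Y ⥤ StarPolycat.{u} X) (adj : L ⊣ StarPolycat.forget.{u} h),
      L.Full ∧ L.Faithful ∧ IsIso adj.unit ∧
      ∀ P : StarPolycat.{u} X,
        StarPolycat.BijectiveOnObjects (adj.counit.app P) ∧
        StarPolycat.FullyFaithfulExceptZero (adj.counit.app P)) ∧
    (∃ (R : StarPolycat.{u} Y ⥤ StarPolycat.{u} X) (adj : StarPolycat.forget.{u} h ⊣ R),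
      R.Full ∧ R.Faithful ∧ IsIso adj.counit ∧
      ∀ P : StarPolycat.{u} X,
        StarPolycat.BijectiveOnObjects (adj.unit.app P) ∧
        StarPolycat.FullyFaithfulExceptZero (adj.unit.app P)) := by
  have hzero : StarPoly.RemovesZero X Y →
      StarPolycat.HasGoodLeftAdjoint.{u} h ∧ StarPolycat.HasGoodRightAdjoint.{u} h := fun H =>
    ⟨StarPolycat.hasGoodLeftAdjoint_of_removesZero H h,
      StarPolycat.hasGoodRightAdjoint_of_removesZero H h⟩
  rcases hXY with ⟨rfl, rfl⟩ | ⟨rfl, rfl⟩ | ⟨rfl, rfl⟩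
  · refine hzero ?_
    rintro ⟨m, n⟩
    simp only [Set.mem_ofPred_eq, ne_eq, Prod.mk.injEq]
    omega
  · refine hzero ?_
    rintro ⟨m, n⟩
    simp only [Set.mem_ofPred_eq, Set.mem_univ, true_and, ne_eq, Prod.mk.injEq]
    omega
  -- The intermediate set adds to the one-output arities only those `(m, 0)` with `m > 0`, which
  -- rotate to `(m - 1, 1)`.
  · let X' : Set (ℕ × ℕ) := {p | (p.2 = 0 ∨ p.2 = 1) ∧ p ≠ (0, 0)}
    have H : StarPoly.RemovesZero {p | p.2 = 0 ∨ p.2 = 1} X' := fun p => Iff.rfl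
    have h₁ : StarPoly.CoUnary ⊆ X' := fun p hp => ⟨.inr hp, by rintro rfl; cases hp⟩
    have := StarPolycat.isEquivalence_forget_coUnary.{u} h₁ fun p hp => hp.2
    exact ⟨(StarPolycat.hasGoodLeftAdjoint_of_removesZero H H.le).comp_isEquivalence (h := h₁),
      (StarPolycat.hasGoodRightAdjoint_of_removesZero H H.le).comp_isEquivalence (h := h₁)⟩
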